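/- Let $I=(0,1]$ carry Lebesgue measure $\lambda$. For $f\in L^1(I)$ let $f^*$ be the non-increasing right-continuous rearrangement of $|f|$, $f^*(t)=\inf\{\alpha\ge 0:\lambda\{|f|>\alpha\}\le t\}$, and $f^{**}(t)=\frac1t\int_0^t f^*\,d\lambda$. For $s>0$ let $(\rho_s g)(t)=g(st)$ if $0<st\le 1$ and $0$ otherwise. For nonnegative functions write $g\simeq h$ if $C^{-1}h\le g\le Ch$ a.e. on $I$ for some constant $C\ge1$. A symmetric ideal is a linear subspace $X$ with $L^\infty(I)\subseteq X\subseteq L^1(I)$ such that $x\in X$, $|y|\le|x|$ implies $y\in X$, and $x\in X$, $y\in L^1(I)$, $y^*\le x^*$ implies $y\in X$. Let $\mathcal N_f$ be the smallest symmetric ideal that contains $f$. An interval partition $\mathcal B=(b_n)_{n\ge0}$ is given by points $1=b_0>b_1>b_2>\cdots$ with $b_n\to0$; its atoms are the intervals $(b_n,b_{n-1}]$, $n\ge1$. It is monotonic if the lengths $b_{n-1}-b_n$ do not increase with $n$. $\mathcal B$ averages $X$ if the conditional expectation $E(\cdot|\mathcal B)$ with respect to the $\sigma$-algebra generated by the atoms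 maps $X$ into $X$. Let $\mathcal B^*$ be the unique monotonic interval partition whose sequence of lengths is a permutation of that of $\mathcal B$. The diadic projection $\mathcal B_{(2)}$ is the interval partition whose points are the distinct numbers $2^{\lceil\log_2 b_n\rceil}$, $n\ge 0$. The function $f$ is called $\mathcal B$-regular if $\mathcal B^*$ averages $\mathcal N_f$. For a function $g$ on $I$ let $g_{\mathcal B}=\sum_{n\ge1}g(b_{n-1})1_{(b_n,b_{n-1}]}$, and $f^{**}_{\mathcal B}=(f^{**})_{\mathcal B}$. Theorem. Let $f\in L^1(I)$ and let $\mathcal B=(b_n)$ be an interval partition. (a) If $\mathcal B$ averages $\mathcal N_f$, then there is a constant $Q>1$ such that $$f^{**}(b_n)\le Q\,f^*(b_n/Q),\qquad n\ge1.\tag{1}$$ (b) If $\mathcal B$ is monotonic and (1) holds for some $Q>1$, then $\mathcal B$ averages $\mathcal N_f$. (c) The following are equivalent: (i) $f$ is $\mathcal B$-regular; (ii) condition (1) holds, for some $Q>1$, for the points of $\mathcal B^*$ in place of those of $\mathcal B$; (iii) $f^{**}_{\mathcal B^*}\simeq(\rho_{1/Q}f^*)_{\mathcal B^*}$ for some $Q>1$;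 (iv) $f^{**}_{\mathcal B^*}$ is integrable and belongs to $\mathcal N_f$; (v) $f$ is $\mathcal B^*_{(2)}$-regular. -/

import Mathlib

open MeasureTheory Set Filter Topology

noncomputable section

namespace SymIdeal

/-- The probability space `I = (0, 1]` with Lebesgue measure, realised as a measure on `ℝ`. -/
abbrev lam : Measure ℝ := volume.restrict (Ioc (0 : ℝ) 1)

instance : IsProbabilityMeasure lam := ⟨by simp [lam]⟩

/-- The space `L¹(I)` (classes of a.e. equal integrable functions). -/
abbrev L1I : Type := Lp ℝ 1 lam

/-- The non-increasing rearrangement `f*` of `|f|`, given by its usual formula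
`f*(t) = inf {α ≥ 0 : λ{|f| > α} ≤ t}`; it is continuous from the right. -/
def rearr (f : ℝ → ℝ) (t : ℝ) : ℝ :=
  sInf {α : ℝ | 0 ≤ α ∧ lam {x | α < |f x|} ≤ ENNReal.ofReal t}

/-- `f**(t) = (1/t) ∫₀ᵗ f*`. -/
def rearrAvg (f : ℝ → ℝ) (t : ℝ) : ℝ :=
  t⁻¹ * ∫ s in (0 : ℝ)..t, rearr f s

/-- The compression-dilation operator `ρ_s`: `(ρ_s g)(t) = g(st)` if `0 < st ≤ 1`, else `0`. -/
def dil (s : ℝ) (g : ℝ → ℝ) (t : ℝ) : ℝ :=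
  if 0 < s * t ∧ s * t ≤ 1 then g (s * t) else 0

/-- Equivalence of functions on `I`: `C⁻¹ g ≤ f ≤ C g` a.e. for some constant `C ≥ 1`. -/
def FunEquiv (f g : ℝ → ℝ) : Prop :=
  ∃ C : ℝ, 1 ≤ C ∧ ∀ᵐ t ∂lam, C⁻¹ * g t ≤ f t ∧ f t ≤ C * g t

/-- Order ideals `L^∞(I) ⊆ X ⊆ L¹(I)`. -/
structure IsOrderIdeal (X : Submodule ℝ L1I) : Prop where
  bounded_mem : ∀ x : L1I, MemLp (x : ℝ → ℝ) ⊤ lam → x ∈ X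
  solid : ∀ x ∈ X, ∀ y : L1I, |y| ≤ |x| → y ∈ X

/-- Symmetric ideals: order ideals with `x ∈ X`, `y* ≤ x*` implies `y ∈ X`. -/
structure IsSymmetricIdeal (X : Submodule ℝ L1I) : Prop extends IsOrderIdeal X where
  symm_mem : ∀ x ∈ X, ∀ y : L1I,
    (∀ t ∈ Ioc (0 : ℝ) 1, rearr y t ≤ rearr x t) → y ∈ X

/-- The principal symmetric ideal `N_f`: the smallest symmetric ideal containing `f`. -/
def principal (f : L1I) : Submodule ℝ L1I :=
  sInf {X | IsSymmetricIdeal X ∧ f ∈ X}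

/-- `N_f` is indeed the least symmetric ideal that contains `f`. -/
theorem principal_isLeast (f : L1I) :
    IsLeast {X : Submodule ℝ L1I | IsSymmetricIdeal X ∧ f ∈ X} (principal f) := by
  refine ⟨⟨⟨⟨?_, ?_⟩, ?_⟩, ?_⟩, fun X hX => sInf_le hX⟩
  · intro x hx
    exact Submodule.mem_sInf.2 fun X hX => hX.1.bounded_mem x hx
  · intro x hx y hy
    exact Submodule.mem_sInf.2 fun X hX => hX.1.solid x (Submodule.mem_sInf.1 hx X hX) y hy
  · intro x hx y hy
    exact Submodule.mem_sInf.2 fun X hX => hX.1.symm_mem x (Submodule.mem_sInf.1 hx X hX) y hy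
  · exact Submodule.mem_sInf.2 fun X hX => hX.2

/-- A function on `I` is integrable and its class belongs to `X`. -/
def MemIdeal (g : ℝ → ℝ) (X : Submodule ℝ L1I) : Prop :=
  ∃ h : Integrable g lam, h.toL1 g ∈ X

/-- Interval partitions `(b_n)`: `1 = b_0 > b_1 > ⋯`, `b_n → 0`, with atoms
`(b_{n+1}, b_n]`, `n = 0, 1, …`. -/
structure IntervalPartition where
  pt : ℕ → ℝ
  pt_zero : pt 0 = 1
  strictAnti : StrictAnti pt
  tendsto : Tendsto pt atTop (𝓝 0)

namespace IntervalPartition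

/-- The atoms of the partition. -/
def atom (B : IntervalPartition) (n : ℕ) : Set ℝ := Ioc (B.pt (n + 1)) (B.pt n)

/-- The lengths of the atoms, i.e. the stochastic vector of the partition. -/
def len (B : IntervalPartition) (n : ℕ) : ℝ := B.pt n - B.pt (n + 1)

/-- The σ-algebra generated by the partition. -/
abbrev sigma (B : IntervalPartition) : MeasurableSpace ℝ :=
  MeasurableSpace.generateFrom (range B.atom)

theorem sigma_le (B : IntervalPartition) : B.sigma ≤ (inferInstance : MeasurableSpace ℝ) := by
  refine MeasurableSpace.generateFrom_le ?_
  rintro _ ⟨n, rfl⟩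
  exact measurableSet_Ioc

/-- The averaging operator `E(· | B)` on `L¹(I)`: conditional expectation. -/
def expect (B : IntervalPartition) (x : L1I) : L1I :=
  (integrable_condExp (m := B.sigma) (μ := lam) (f := (x : ℝ → ℝ))).toL1 _

/-- `B` averages `X` if `E(X | B) ⊆ X`. -/
def Averages (B : IntervalPartition) (X : Submodule ℝ L1I) : Prop :=
  ∀ x ∈ X, B.expect x ∈ X

/-- Monotonic interval partitions: the lengths of the atoms do not increase towards `0`. -/
def IsMonotonic (B : IntervalPartition) : Prop := Antitone B.len

/-- `g_B`: the step function with the value `g(b_n)` on the atom `(b_{n+1}, b_n]`. -/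
def step (B : IntervalPartition) (g : ℝ → ℝ) (t : ℝ) : ℝ :=
  ∑' n : ℕ, (B.atom n).indicator (fun _ => g (B.pt n)) t

theorem pt_pos (B : IntervalPartition) (n : ℕ) : 0 < B.pt n :=
  (B.strictAnti.antitone.le_of_tendsto B.tendsto (n + 1)).trans_lt
    (B.strictAnti (Nat.lt_succ_self n))

theorem pt_le_one (B : IntervalPartition) (n : ℕ) : B.pt n ≤ 1 :=
  B.pt_zero ▸ B.strictAnti.antitone (Nat.zero_le n)

theorem len_pos (B : IntervalPartition) (n : ℕ) : 0 < B.len n :=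
  sub_pos.2 (B.strictAnti (Nat.lt_succ_self n))

theorem hasSum_len (B : IntervalPartition) : HasSum B.len 1 := by
  rw [hasSum_iff_tendsto_nat_of_nonneg fun n => (B.len_pos n).le]
  have h : (fun n => ∑ i ∈ Finset.range n, B.len i) = fun n => 1 - B.pt n := by
    funext n
    rw [← B.pt_zero, ← Finset.sum_range_sub' B.pt n]
    rfl
  rw [h]
  simpa using B.tendsto.const_sub 1

/-- A sequence of positive numbers that tends to `0` can be permuted to be non-increasing. -/
theorem exists_perm_antitone (u : ℕ → ℝ) (hu : ∀ n, 0 < u n) (h0 : Tendsto u atTop (𝓝 0)) :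
    ∃ σ : Equiv.Perm ℕ, Antitone fun n => u (σ n) := by
  let S : ℕ → Set ℕ := fun k => {j | u k < u j ∨ (u j = u k ∧ j < k)}
  have hfin : ∀ k, (S k).Finite := by
    intro k
    have h1 : ∀ᶠ n in atTop, u n < u k := h0.eventually_lt_const (hu k)
    obtain ⟨N, hN⟩ := eventually_atTop.1 h1
    refine (finite_lt_nat N).subset ?_
    intro j hj
    by_contra hc
    have h2 := hN j (not_lt.1 hc)
    rcases hj with h | h
    · exact absurd h2 (not_lt.2 h.le)
    · exact absurd h.1 h2.ne
  let r : ℕ → ℕ := fun k => (S k).ncard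
  have hlt : ∀ j k, j ∈ S k → r j < r k := by
    intro j k hjk
    refine ncard_lt_ncard ⟨?_, ?_⟩ (hfin k)
    · intro i hi
      simp only [S, mem_ofPred_eq] at *
      grind
    · intro hsub
      have := hsub hjk
      simp [S] at this
  have htri : ∀ j k, j ≠ k → j ∈ S k ∨ k ∈ S j := by
    intro j k hjk
    simp only [S, mem_ofPred_eq]
    grind
  have hinj : Function.Injective r := by
    intro j k hjk
    by_contra hne
    rcases htri j k hne with h | h
    · exact absurd hjk (hlt _ _ h).ne
    · exact absurd hjk (hlt _ _ h).ne'
  have himg : ∀ k, r '' S k = Iio (r k) := by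
    intro k
    refine eq_of_subset_of_ncard_le ?_ ?_ (finite_Iio _)
    · rintro _ ⟨j, hj, rfl⟩
      exact hlt j k hj
    · rw [ncard_image_of_injective _ hinj, ncard_eq_toFinset_card' (Iio (r k))]
      simp [r]
  have hsurj : Function.Surjective r := by
    intro m
    obtain ⟨k, hk⟩ : ∃ k, m < r k := by
      by_contra hc
      push Not at hc
      exact (infinite_range_of_injective hinj) ((finite_Iic m).subset
        (by rintro _ ⟨k, rfl⟩; exact hc k))
    have : m ∈ r '' S k := by rw [himg]; exact hk
    obtain ⟨j, -, hj⟩ := this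
    exact ⟨j, hj⟩
  refine ⟨(Equiv.ofBijective r ⟨hinj, hsurj⟩).symm, ?_⟩
  intro m n hmn
  by_contra hc
  have h1 := hlt _ _ (Or.inl (not_le.1 hc) :
    (Equiv.ofBijective r ⟨hinj, hsurj⟩).symm n ∈ S ((Equiv.ofBijective r ⟨hinj, hsurj⟩).symm m))
  have h2 : ∀ i, r ((Equiv.ofBijective r ⟨hinj, hsurj⟩).symm i) = i := fun i =>
    (Equiv.ofBijective r ⟨hinj, hsurj⟩).apply_symm_apply i
  rw [h2, h2] at h1
  omega

theorem exists_star (B : IntervalPartition) : ∃ B' : IntervalPartition, B'.IsMonotonic ∧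
    ∃ σ : Equiv.Perm ℕ, ∀ n, B'.len n = B.len (σ n) := by
  obtain ⟨σ, hσ⟩ := exists_perm_antitone B.len B.len_pos
    (B.hasSum_len.summable.tendsto_atTop_zero)
  have hs : HasSum (fun n => B.len (σ n)) 1 := (Equiv.hasSum_iff σ).2 B.hasSum_len
  let B' : IntervalPartition :=
    { pt := fun n => 1 - ∑ i ∈ Finset.range n, B.len (σ i)
      pt_zero := by simp
      strictAnti := strictAnti_nat_of_succ_lt fun n => by
        rw [Finset.sum_range_succ]
        linarith [B.len_pos (σ n)]
      tendsto := by simpa using hs.tendsto_sum_nat.const_sub 1 }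
  have hlen : ∀ n, B'.len n = B.len (σ n) := by
    intro n
    have : B'.len n = (1 - ∑ i ∈ Finset.range n, B.len (σ i)) -
        (1 - ∑ i ∈ Finset.range (n + 1), B.len (σ i)) := rfl
    rw [this, Finset.sum_range_succ]
    ring
  refine ⟨B', ?_, σ, hlen⟩
  intro m n hmn
  rw [hlen, hlen]
  exact hσ hmn

/-- `B*`: the (unique) monotonic interval partition whose stochastic vector is a permutation of
that of `B`. -/
def star (B : IntervalPartition) : IntervalPartition := B.exists_star.choose

theorem star_isMonotonic (B : IntervalPartition) : B.star.IsMonotonic :=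
  B.exists_star.choose_spec.1

theorem star_len (B : IntervalPartition) :
    ∃ σ : Equiv.Perm ℕ, ∀ n, B.star.len n = B.len (σ n) :=
  B.exists_star.choose_spec.2

/-- The exponents `m` such that some point of `B` lies in `(2^{-m-1}, 2^{-m}]`. -/
def dyadicExp (B : IntervalPartition) : Set ℕ := {m | ∃ n, Int.clog 2 (B.pt n) = -(m : ℤ)}

theorem exists_mem_dyadicExp (B : IntervalPartition) (n : ℕ) :
    ∃ m ∈ B.dyadicExp, B.pt n ≤ (2 : ℝ)⁻¹ ^ m ∧ (2 : ℝ)⁻¹ ^ (m + 1) < B.pt n := by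
  have h1 : Int.clog 2 (B.pt n) ≤ 0 := by
    have := Int.clog_mono_right (b := 2) (B.pt_pos n) (B.pt_le_one n)
    simpa using this
  obtain ⟨m, hm⟩ := Int.eq_ofNat_of_zero_le (neg_nonneg.2 h1)
  have hm' : Int.clog 2 (B.pt n) = -(m : ℤ) := by omega
  refine ⟨m, ⟨n, hm'⟩, ?_, ?_⟩
  · have := Int.self_le_zpow_clog (b := 2) (by norm_num) (B.pt n)
    rw [hm'] at this
    simpa [zpow_neg] using this
  · have := Int.zpow_pred_clog_lt_self (b := 2) (by norm_num) (B.pt_pos n)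
    rw [hm', show (-(m : ℤ) - 1) = -((m + 1 : ℕ) : ℤ) by push_cast; ring] at this
    simpa only [zpow_neg, zpow_natCast, inv_pow, Nat.cast_ofNat] using this

theorem dyadicExp_infinite (B : IntervalPartition) : B.dyadicExp.Infinite := by
  rw [infinite_iff_exists_gt]
  intro a
  have hpos : (0 : ℝ) < 2⁻¹ ^ (a + 1) := by positivity
  obtain ⟨n, hn⟩ := (B.tendsto.eventually_lt_const hpos).exists
  obtain ⟨m, hm, -, h2⟩ := B.exists_mem_dyadicExp n
  refine ⟨m, hm, ?_⟩
  by_contra hc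
  have : (2 : ℝ)⁻¹ ^ (a + 1) ≤ 2⁻¹ ^ (m + 1) :=
    pow_le_pow_of_le_one (by norm_num) (by norm_num) (by omega)
  linarith

/-- The (right) diadic projection `B_(2)`: every point `b_n` is replaced by the right end of the
diadic interval `(2^{-m-1}, 2^{-m}]` that contains it, and the distinct points so obtained are
listed in decreasing order. -/
def dyadic (B : IntervalPartition) : IntervalPartition where
  pt k := (2 : ℝ)⁻¹ ^ Nat.nth (· ∈ B.dyadicExp) k
  pt_zero := by
    have h0 : 0 ∈ B.dyadicExp := ⟨0, by simp [B.pt_zero]⟩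
    rw [Nat.nth_zero_of_zero h0, pow_zero]
  strictAnti := fun _ _ h => pow_lt_pow_right_of_lt_one₀ (by norm_num) (by norm_num)
    (Nat.nth_strictMono B.dyadicExp_infinite h)
  tendsto := (tendsto_pow_atTop_nhds_zero_of_lt_one (by norm_num) (by norm_num)).comp
    (Nat.nth_strictMono B.dyadicExp_infinite).tendsto_atTop

/-- `f` is `B`-regular if the monotonic partition `B*` averages `N_f`. -/
def Regular (B : IntervalPartition) (f : L1I) : Prop := B.star.Averages (principal f)

end IntervalPartition

end SymIdeal

end

/-! Everything rests on a concrete description of the principal ideal: $x\in\mathcal N_f$ iff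
$x^*(t)\le C(f^*(t/C)+1)$ on $I$ for some $C\ge1$ (`mem_principal_iff`). Such $x$ form a symmetric
ideal. Conversely, a symmetric ideal containing $f$ contains $C(|f|+1)$, and the rearrangement of an
element can be dilated by 2, because $h^*(t)+h^*(1-t)$ rearranges to something above $h^*(t/2)$.
Condition (1) is therefore studied as `RegularOn`, where the additive constant is harmless: it is
absorbed once $f\ne0$.

Sufficiency for monotonic $\mathcal B$ (`rearr_expect_le`): a level set $S$ of $E(x|\mathcal B)$ is
a union of atoms. If its measure exceeds some $t$ in the atom $(b_{n+1},b_n]$ (counted from $n=0$),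
it contains an atom at least as long as that one, so its measure is at least $b_n/2$. The level is
at most the mean of $|x|$ over $S$, hence at most $x^{**}(b_n/2)\le 2x^{**}(b_n)$, and $x^{**}$ is
controlled by $f^{**}$.

Necessity for any $\mathcal B$ (`regularOn_of_averages`): if regularity fails, pick rapidly
decreasing points $b_{n_k}$ where it fails with constants tending to infinity. On every atom inside
a block $(b_{n_{k+1}},b_{n_k}]$ place a compressed copy of $f^*$ restricted to that block. The
result has rearrangement at most $f^*$, so it lies in $\mathcal N_f$, but its conditional
expectation is at least $f^{**}(b_{n_k})/2$ on the whole block, which is too large for $\mathcal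
N_f$.

The equivalences in (c) then compare the step function of $f^{**}$ with $f^*$ at the points of
$\mathcal B^*$; regularity is insensitive to moving points by a factor of 2, which gives the diadic
statement. -/

noncomputable section

namespace SymIdeal

/-! ### Distribution functions, rearrangements and their averages -/

section Rearrangement

variable {f g : ℝ → ℝ} {s t α : ℝ}

theorem rearr_nonneg (f : ℝ → ℝ) (t : ℝ) : 0 ≤ rearr f t :=
  Real.sInf_nonneg fun _ h => h.1

theorem rearr_le (hα : 0 ≤ α) (h : lam {x | α < |f x|} ≤ ENNReal.ofReal t) : rearr f t ≤ α :=
  csInf_le ⟨0, fun _ h => h.1⟩ ⟨hα, h⟩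

theorem rearr_one (f : ℝ → ℝ) : rearr f 1 = 0 :=
  le_antisymm (rearr_le le_rfl (by rw [ENNReal.ofReal_one]; exact prob_le_one)) (rearr_nonneg _ _)

theorem rearr_congr (h : f =ᵐ[lam] g) : rearr f = rearr g := by
  funext t
  have : ∀ α, lam {x | α < |f x|} = lam {x | α < |g x|} := fun α =>
    measure_congr (by
      filter_upwards [h] with x hx
      simp only [eq_iff_iff]
      change α < |f x| ↔ α < |g x|
      rw [hx])
  simp only [rearr, this]

theorem nullMeasurableSet_level (hf : AEMeasurable f lam) (α : ℝ) :
    NullMeasurableSet {x | α < |f x|} lam :=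
  nullMeasurableSet_lt aemeasurable_const (by simpa [Real.norm_eq_abs] using hf.norm)

/-- Ensures that the infimum defining $f^*(t)$ is over a nonempty set, so that the default value
`sInf ∅ = 0` does not occur for $t>0$. -/
theorem exists_level_le (hf : AEMeasurable f lam) (ht : 0 < t) :
    ∃ α : ℝ, 0 ≤ α ∧ lam {x | α < |f x|} ≤ ENNReal.ofReal t := by
  have h : Tendsto (fun n : ℕ => lam {x | (n : ℝ) < |f x|}) atTop
      (𝓝 (lam (⋂ n : ℕ, {x | (n : ℝ) < |f x|}))) := by
    refine tendsto_measure_iInter_atTop (fun n => nullMeasurableSet_level hf _) ?_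
      ⟨0, measure_ne_top _ _⟩
    intro m n hmn x hx
    exact lt_of_le_of_lt (Nat.cast_le.2 hmn) (show (n : ℝ) < |f x| from hx)
  have h0 : (⋂ n : ℕ, {x | (n : ℝ) < |f x|}) = ∅ := by
    refine eq_empty_of_forall_notMem fun x hx => ?_
    obtain ⟨n, hn⟩ := exists_nat_gt |f x|
    exact lt_asymm hn (mem_iInter.1 hx n)
  rw [h0, measure_empty] at h
  obtain ⟨n, hn⟩ := (h.eventually_lt_const (ENNReal.ofReal_pos.2 ht)).exists
  exact ⟨n, n.cast_nonneg, hn.le⟩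

/-- The infimum is attained: the level set at $f^*(t)$ is the increasing union of level sets at
strictly larger heights, each of measure at most $t$. -/
theorem level_rearr_le (hf : AEMeasurable f lam) (ht : 0 < t) :
    lam {x | rearr f t < |f x|} ≤ ENNReal.ofReal t := by
  have h : {x | rearr f t < |f x|} = ⋃ n : ℕ, {x | rearr f t + 1 / ((n : ℝ) + 1) < |f x|} := by
    ext x
    simp only [mem_iUnion]
    constructor
    · intro hx
      obtain ⟨n, hn⟩ := exists_nat_one_div_lt (sub_pos.2 (show rearr f t < |f x| from hx))
      exact ⟨n, by rw [mem_ofPred_eq]; linarith⟩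
    · rintro ⟨n, hn⟩
      have : (0 : ℝ) < 1 / ((n : ℝ) + 1) := by positivity
      rw [mem_ofPred_eq] at hn ⊢
      linarith
  have hmono : Monotone fun n : ℕ => {x | rearr f t + 1 / ((n : ℝ) + 1) < |f x|} := by
    intro m n hmn x hx
    have := Nat.one_div_le_one_div (α := ℝ) hmn
    simp only [mem_ofPred_eq] at hx ⊢
    linarith
  rw [h, hmono.measure_iUnion]
  refine iSup_le fun n => ?_
  have hpos : (0 : ℝ) < 1 / ((n : ℝ) + 1) := by positivity
  obtain ⟨β, hβ, hlt⟩ := exists_lt_of_csInf_lt (exists_level_le hf ht)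
    (show sInf {α : ℝ | 0 ≤ α ∧ lam {x | α < |f x|} ≤ ENNReal.ofReal t} <
      rearr f t + 1 / ((n : ℝ) + 1) from lt_add_of_pos_right _ hpos)
  exact (measure_mono fun x hx => hlt.trans hx).trans hβ.2

theorem rearr_le_iff (hf : AEMeasurable f lam) (ht : 0 < t) (hα : 0 ≤ α) :
    rearr f t ≤ α ↔ lam {x | α < |f x|} ≤ ENNReal.ofReal t :=
  ⟨fun h => (measure_mono fun _ hx => h.trans_lt hx).trans (level_rearr_le hf ht), rearr_le hα⟩

theorem lt_rearr_iff (hf : AEMeasurable f lam) (ht : 0 < t) (hα : 0 ≤ α) :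
    α < rearr f t ↔ ENNReal.ofReal t < lam {x | α < |f x|} := by
  rw [← not_le, rearr_le_iff hf ht hα, not_le]

theorem le_rearr_of_level (hf : AEMeasurable f lam) (ht : 0 < t)
    (h : ∀ β, 0 ≤ β → β < α → ENNReal.ofReal t < lam {x | β < |f x|}) : α ≤ rearr f t := by
  by_contra hc
  exact (lt_irrefl _) ((lt_rearr_iff hf ht (rearr_nonneg _ _)).2
    (h _ (rearr_nonneg _ _) (not_le.1 hc)))

theorem rearr_anti (hf : AEMeasurable f lam) (hs : 0 < s) (hst : s ≤ t) :
    rearr f t ≤ rearr f s :=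
  rearr_le (rearr_nonneg _ _) ((level_rearr_le hf hs).trans (ENNReal.ofReal_le_ofReal hst))

theorem rearr_mono (hf : AEMeasurable f lam) (ht : 0 < t) (h : ∀ᵐ x ∂lam, |g x| ≤ |f x|) :
    rearr g t ≤ rearr f t := by
  refine rearr_le (rearr_nonneg _ _) (le_trans (measure_mono_ae ?_) (level_rearr_le hf ht))
  filter_upwards [h] with x hx h1
  exact lt_of_lt_of_le h1 hx

/-- The level set at $\alpha$ is confined to $(0,t)$; neither monotonicity nor measurability of $g$
plays a role. -/
theorem rearr_le_of_forall_ge (hα : 0 ≤ α) (h : ∀ x ∈ Ioc (0 : ℝ) 1, t ≤ x → |g x| ≤ α) :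
    rearr g t ≤ α := by
  refine rearr_le hα ?_
  have hsub : {x | α < |g x|} ∩ Ioc (0 : ℝ) 1 ⊆ Ioo 0 t := by
    rintro x ⟨hx, hx1⟩
    refine ⟨hx1.1, ?_⟩
    by_contra hc
    exact absurd (h x hx1 (not_lt.1 hc)) (not_le.2 hx)
  rw [Measure.restrict_apply' measurableSet_Ioc]
  simpa using measure_mono (μ := volume) hsub

theorem rearr_add_le (hf : AEMeasurable f lam) (hg : AEMeasurable g lam) (ht : 0 < t) :
    rearr (fun x => f x + g x) t ≤ rearr f (t / 2) + rearr g (t / 2) := by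
  refine rearr_le (add_nonneg (rearr_nonneg _ _) (rearr_nonneg _ _)) ?_
  have hsub : {x | rearr f (t / 2) + rearr g (t / 2) < |f x + g x|} ⊆
      {x | rearr f (t / 2) < |f x|} ∪ {x | rearr g (t / 2) < |g x|} := by
    intro x hx
    by_contra hc
    simp only [mem_union, not_or] at hc
    have h1 : |f x| ≤ rearr f (t / 2) := not_lt.1 hc.1
    have h2 : |g x| ≤ rearr g (t / 2) := not_lt.1 hc.2
    have h3 := abs_add_le (f x) (g x)
    rw [mem_ofPred_eq] at hx
    linarith
  refine (measure_mono hsub).trans ((measure_union_le _ _).trans ?_)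
  refine (add_le_add (level_rearr_le hf (half_pos ht)) (level_rearr_le hg (half_pos ht))).trans ?_
  rw [← ENNReal.ofReal_add (half_pos ht).le (half_pos ht).le, add_halves]

theorem level_le_of_rearr_le (hf : AEMeasurable f lam) (hg : AEMeasurable g lam)
    (h : ∀ t ∈ Ioo (0 : ℝ) 1, rearr g t ≤ rearr f t) (hα : 0 ≤ α) :
    lam {x | α < |g x|} ≤ lam {x | α < |f x|} := by
  by_contra hc
  obtain ⟨t, ht0, h1, h2⟩ := ENNReal.lt_iff_exists_real_btwn.1 (not_le.1 hc)
  have htpos : 0 < t := ENNReal.ofReal_pos.1 (bot_le.trans_lt h1)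
  have ht1 : t < 1 := by
    have : ENNReal.ofReal t < 1 := h2.trans_le prob_le_one
    simpa using this
  have h3 := (lt_rearr_iff hg htpos hα).2 h2
  have h4 := (rearr_le_iff hf htpos hα).2 h1.le
  linarith [h t ⟨htpos, ht1⟩]

theorem lintegral_abs_le_of_level_le (hf : AEMeasurable f lam) (hg : AEMeasurable g lam)
    (h : ∀ α, 0 ≤ α → lam {x | α < |g x|} ≤ lam {x | α < |f x|}) :
    ∫⁻ x, ENNReal.ofReal |g x| ∂lam ≤ ∫⁻ x, ENNReal.ofReal |f x| ∂lam := by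
  have hf' : AEMeasurable (fun x => |f x|) lam := by simpa [Real.norm_eq_abs] using hf.norm
  have hg' : AEMeasurable (fun x => |g x|) lam := by simpa [Real.norm_eq_abs] using hg.norm
  rw [lintegral_eq_lintegral_meas_lt lam (ae_of_all _ fun x => abs_nonneg (f x)) hf',
    lintegral_eq_lintegral_meas_lt lam (ae_of_all _ fun x => abs_nonneg (g x)) hg']
  exact setLIntegral_mono' measurableSet_Ioi fun α hα => h α (le_of_lt hα)

theorem integrable_of_level_le (hf : Integrable f lam) (hg : AEMeasurable g lam)
    (h : ∀ α, 0 ≤ α → lam {x | α < |g x|} ≤ lam {x | α < |f x|}) : Integrable g lam := by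
  refine ⟨hg.aestronglyMeasurable, ?_⟩
  have := hf.hasFiniteIntegral
  rw [hasFiniteIntegral_iff_norm] at this ⊢
  exact (lintegral_abs_le_of_level_le hf.aemeasurable hg h).trans_lt this

theorem integral_abs_le_of_level_le (hf : Integrable f lam) (hg : AEMeasurable g lam)
    (h : ∀ α, 0 ≤ α → lam {x | α < |g x|} ≤ lam {x | α < |f x|}) :
    ∫ x, |g x| ∂lam ≤ ∫ x, |f x| ∂lam := by
  have hg' := integrable_of_level_le hf hg h
  rw [integral_eq_lintegral_of_nonneg_ae (ae_of_all _ fun x => abs_nonneg (f x))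
      hf.abs.aestronglyMeasurable,
    integral_eq_lintegral_of_nonneg_ae (ae_of_all _ fun x => abs_nonneg (g x))
      hg'.abs.aestronglyMeasurable]
  refine ENNReal.toReal_mono ?_ (lintegral_abs_le_of_level_le hf.aemeasurable hg h)
  have := hf.hasFiniteIntegral
  rw [hasFiniteIntegral_iff_norm] at this
  exact this.ne

theorem integrable_of_rearr_le (hf : Integrable f lam) (hg : AEMeasurable g lam)
    (h : ∀ t ∈ Ioo (0 : ℝ) 1, rearr g t ≤ rearr f t) : Integrable g lam :=
  integrable_of_level_le hf hg fun _ hα => level_le_of_rearr_le hf.aemeasurable hg h hα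

theorem aemeasurable_rearr (hf : AEMeasurable f lam) : AEMeasurable (rearr f) lam :=
  aemeasurable_restrict_of_antitoneOn measurableSet_Ioc
    fun _ hx _ _ hxy => rearr_anti hf hx.1 hxy

theorem rearr_rearr_le (hf : AEMeasurable f lam) (ht : 0 < t) :
    rearr (rearr f) t ≤ rearr f t :=
  rearr_le_of_forall_ge (rearr_nonneg _ _) fun x _ htx => by
    rw [abs_of_nonneg (rearr_nonneg _ _)]
    exact rearr_anti hf ht htx

theorem integrable_rearr (hf : Integrable f lam) : Integrable (rearr f) lam :=
  integrable_of_rearr_le hf (aemeasurable_rearr hf.aemeasurable)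
    fun _ ht => rearr_rearr_le hf.aemeasurable ht.1

theorem lt_rearr_of_lt_level (hf : AEMeasurable f lam) (hs : 0 < s) (hα : 0 ≤ α)
    (h : s < (lam {x | α < |f x|}).toReal) : α < rearr f s :=
  (lt_rearr_iff hf hs hα).2 ((ENNReal.ofReal_lt_iff_lt_toReal hs.le (measure_ne_top _ _)).2 h)

/-- Hardy–Littlewood inequality, by comparing distribution functions. With
$d=\lambda\{|f|>\alpha\}$, the level set of $f1_S$ has measure at most $\min(r,d)$, while that of
$f^*1_{(0,r)}$ contains the interval $(0,\min(r,d))$. -/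
theorem setIntegral_abs_le (hf : Integrable f lam) {S : Set ℝ} (hS : MeasurableSet S) :
    ∫ x in S, |f x| ∂lam ≤ ∫ x in (0 : ℝ)..(lam S).toReal, rearr f x := by
  set r := (lam S).toReal with hr
  have hr1 : r ≤ 1 := ENNReal.toReal_le_of_le_ofReal zero_le_one (by rw [ENNReal.ofReal_one]; exact prob_le_one)
  have hr0 : 0 ≤ r := ENNReal.toReal_nonneg
  have h1 : ∫ x in S, |f x| ∂lam = ∫ x, |S.indicator f x| ∂lam := by
    rw [← integral_indicator hS]
    congr 1
    funext x
    by_cases hx : x ∈ S <;> simp [hx]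
  have h2 : ∫ x in (0 : ℝ)..r, rearr f x = ∫ x, |(Ioo 0 r).indicator (rearr f) x| ∂lam := by
    rw [intervalIntegral.integral_of_le hr0, integral_Ioc_eq_integral_Ioo]
    have : ∀ x, |(Ioo 0 r).indicator (rearr f) x| = (Ioo 0 r).indicator (rearr f) x := fun x =>
      abs_of_nonneg (indicator_nonneg (fun _ _ => rearr_nonneg _ _) _)
    simp only [this]
    rw [integral_indicator measurableSet_Ioo, Measure.restrict_restrict measurableSet_Ioo,
      inter_eq_left.2 (Ioo_subset_Ioc_self.trans (Ioc_subset_Ioc_right hr1))]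
  rw [h1, h2]
  refine integral_abs_le_of_level_le ((integrable_rearr hf).indicator measurableSet_Ioo)
    (hf.aemeasurable.indicator hS) fun α hα => ?_
  set d := (lam {x | α < |f x|}).toReal with hd
  have hm : lam {x | α < |S.indicator f x|} ≤ ENNReal.ofReal (min r d) := by
    rw [ENNReal.ofReal_min, hr, hd, ENNReal.ofReal_toReal (measure_ne_top _ _),
      ENNReal.ofReal_toReal (measure_ne_top _ _)]
    refine le_min (measure_mono fun x hx => ?_) (measure_mono fun x hx => ?_)
    · by_contra hxS
      rw [mem_ofPred_eq] at hx
      rw [indicator_of_notMem hxS, abs_zero] at hx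
      linarith
    · by_cases hxS : x ∈ S
      · rw [mem_ofPred_eq] at hx
        rwa [indicator_of_mem hxS] at hx
      · rw [mem_ofPred_eq] at hx
        rw [indicator_of_notMem hxS, abs_zero] at hx
        linarith
  refine hm.trans ?_
  have hvol : ENNReal.ofReal (min r d) = lam (Ioo 0 (min r d)) := by
    rw [Measure.restrict_apply measurableSet_Ioo,
      inter_eq_left.2 (Ioo_subset_Ioc_self.trans
        (Ioc_subset_Ioc_right ((min_le_left _ _).trans hr1)))]
    simp
  rw [hvol]
  refine measure_mono fun x hx => ?_
  rw [mem_ofPred_eq]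
  rw [indicator_of_mem (show x ∈ Ioo 0 r from ⟨hx.1, hx.2.trans_le (min_le_left _ _)⟩),
    abs_of_nonneg (rearr_nonneg _ _)]
  exact lt_rearr_of_lt_level hf.aemeasurable hx.1 hα (hx.2.trans_le (min_le_right _ _))

theorem intervalIntegrable_rearr (hf : Integrable f lam) (hs : s ∈ Icc (0 : ℝ) 1)
    (ht : t ∈ Icc (0 : ℝ) 1) : IntervalIntegrable (rearr f) volume s t := by
  have h : IntegrableOn (rearr f) (Ioc 0 1) volume := integrable_rearr hf
  rw [intervalIntegrable_iff]
  refine h.mono_set ?_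
  rintro x ⟨hx1, hx2⟩
  exact ⟨(le_min hs.1 ht.1).trans_lt hx1, hx2.trans (max_le hs.2 ht.2)⟩

theorem mul_rearr_le_integral (hf : Integrable f lam) (ht : t ∈ Ioc (0 : ℝ) 1) :
    t * rearr f t ≤ ∫ x in (0 : ℝ)..t, rearr f x := by
  have h := intervalIntegral.integral_mono_on_of_le_Ioo (μ := volume) (f := fun _ => rearr f t)
    (g := rearr f) ht.1.le intervalIntegrable_const
    (intervalIntegrable_rearr hf ⟨le_rfl, zero_le_one⟩ ⟨ht.1.le, ht.2⟩)
    (fun x hx => rearr_anti hf.aemeasurable hx.1 hx.2.le)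
  simpa using h

theorem integral_rearr_mono (hf : Integrable f lam) (hs : 0 ≤ s) (hst : s ≤ t) (ht : t ≤ 1) :
    ∫ x in (0 : ℝ)..s, rearr f x ≤ ∫ x in (0 : ℝ)..t, rearr f x :=
  intervalIntegral.integral_mono_interval le_rfl hs hst
    (ae_of_all _ fun _ => rearr_nonneg _ _)
    (intervalIntegrable_rearr hf ⟨le_rfl, zero_le_one⟩ ⟨hs.trans hst, ht⟩)

theorem integral_rearr_nonneg (f : ℝ → ℝ) (ht : 0 ≤ t) : 0 ≤ ∫ x in (0 : ℝ)..t, rearr f x :=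
  intervalIntegral.integral_nonneg ht fun _ _ => rearr_nonneg _ _

theorem rearrAvg_nonneg (f : ℝ → ℝ) (ht : 0 ≤ t) : 0 ≤ rearrAvg f t :=
  mul_nonneg (inv_nonneg.2 ht) (integral_rearr_nonneg f ht)

theorem mul_rearrAvg (f : ℝ → ℝ) (ht : 0 < t) :
    t * rearrAvg f t = ∫ x in (0 : ℝ)..t, rearr f x := by
  rw [rearrAvg, mul_inv_cancel_left₀ ht.ne']

/-- On $(s,t)$ the integrand is at most $f^*(s)\le f^{**}(s)$, so extending the interval cannot
raise the mean. -/
theorem rearrAvg_anti (hf : Integrable f lam) (hs : 0 < s) (hst : s ≤ t) (ht : t ≤ 1) :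
    rearrAvg f t ≤ rearrAvg f s := by
  have ht0 := hs.trans_le hst
  have h1 := intervalIntegral.integral_mono_on_of_le_Ioo (μ := volume) (f := rearr f)
    (g := fun _ => rearr f s) hst
    (intervalIntegrable_rearr hf ⟨hs.le, hst.trans ht⟩ ⟨ht0.le, ht⟩) intervalIntegrable_const
    (fun x hx => rearr_anti hf.aemeasurable hs hx.1.le)
  have h2 := mul_rearr_le_integral hf ⟨hs, hst.trans ht⟩
  have h3 := intervalIntegral.integral_add_adjacent_intervals
    (intervalIntegrable_rearr hf ⟨le_rfl, zero_le_one⟩ ⟨hs.le, hst.trans ht⟩)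
    (intervalIntegrable_rearr hf ⟨hs.le, hst.trans ht⟩ ⟨ht0.le, ht⟩)
  rw [intervalIntegral.integral_const, smul_eq_mul] at h1
  rw [← mul_rearrAvg f hs] at h2 h3
  rw [← mul_rearrAvg f ht0] at h3
  have h4 : rearr f s ≤ rearrAvg f s := le_of_mul_le_mul_left h2 hs
  have h5 := mul_le_mul_of_nonneg_left h4 (sub_nonneg.2 hst)
  refine le_of_mul_le_mul_left ?_ ht0
  linarith

theorem rearrAvg_le_two_mul (hf : Integrable f lam) (hs : 0 < s) (hst : s ≤ t)
    (hts : t ≤ 2 * s) (ht : t ≤ 1) : rearrAvg f s ≤ 2 * rearrAvg f t := by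
  have h := integral_rearr_mono hf hs.le hst ht
  rw [← mul_rearrAvg f hs, ← mul_rearrAvg f (hs.trans_le hst)] at h
  have h2 := mul_le_mul_of_nonneg_right hts (rearrAvg_nonneg f (hs.trans_le hst).le)
  refine le_of_mul_le_mul_left ?_ hs
  linarith

/-- The half of the equivalence in (iii) that needs no regularity. -/
theorem rearr_inv_mul_le (hf : Integrable f lam) (ht : t ∈ Ioc (0 : ℝ) 1) {Q : ℝ} (hQ : 1 ≤ Q) :
    Q⁻¹ * rearr f (Q⁻¹ * t) ≤ rearrAvg f t := by
  have hQ0 : 0 < Q := zero_lt_one.trans_le hQ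
  have h1 : Q⁻¹ * t ≤ t := mul_le_of_le_one_left ht.1.le (inv_le_one_of_one_le₀ hQ)
  have h0 : 0 < Q⁻¹ * t := mul_pos (inv_pos.2 hQ0) ht.1
  have h2 := (mul_rearr_le_integral hf ⟨h0, h1.trans ht.2⟩).trans
    (integral_rearr_mono hf h0.le h1 ht.2)
  rw [← mul_rearrAvg f ht.1] at h2
  refine le_of_mul_le_mul_left ?_ ht.1
  linarith

/-- The dominating function `C (f*(t / C) + 1)` that describes membership in `N_f`. -/
def dominant (f : ℝ → ℝ) (C t : ℝ) : ℝ := C * (rearr f (C⁻¹ * t) + 1)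

theorem dominant_mono (hf : AEMeasurable f lam) (ht : 0 < t) {C D : ℝ} (hC : 1 ≤ C)
    (hCD : C ≤ D) : dominant f C t ≤ dominant f D t := by
  have hC0 : 0 < C := zero_lt_one.trans_le hC
  have hD0 := hC0.trans_le hCD
  refine mul_le_mul hCD (add_le_add (rearr_anti hf (mul_pos (inv_pos.2 hD0) ht) ?_) le_rfl)
    (add_nonneg (rearr_nonneg _ _) zero_le_one) hD0.le
  exact mul_le_mul_of_nonneg_right (inv_anti₀ hC0 hCD) ht.le

theorem le_dominant (hC : 0 ≤ s) : s ≤ dominant f s t :=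
  le_mul_of_one_le_right hC (le_add_of_nonneg_left (rearr_nonneg _ _))

theorem rearr_pos_of_not_ae_zero (hf : AEMeasurable f lam) (h : ¬ f =ᵐ[lam] 0) :
    ∃ t ∈ Ioc (0 : ℝ) 1, 0 < rearr f t := by
  have h0 : lam {x | 0 < |f x|} ≠ 0 := by
    intro h0
    refine h ?_
    rw [Filter.EventuallyEq, ae_iff]
    convert h0 using 3
    simp
  have hpos : 0 < (lam {x | 0 < |f x|}).toReal := ENNReal.toReal_pos h0 (measure_ne_top _ _)
  refine ⟨(lam {x | 0 < |f x|}).toReal / 2, ⟨half_pos hpos, ?_⟩,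
    lt_rearr_of_lt_level hf (half_pos hpos) le_rfl (half_lt_self hpos)⟩
  have : (lam {x | 0 < |f x|}).toReal ≤ 1 :=
    ENNReal.toReal_le_of_le_ofReal zero_le_one (by rw [ENNReal.ofReal_one]; exact prob_le_one)
  linarith

theorem rearr_zero (t : ℝ) : rearr (0 : ℝ → ℝ) t = 0 :=
  le_antisymm (rearr_le le_rfl (by simp)) (rearr_nonneg _ _)

/-- The regularity condition of `f` on a set `T` of points, with an additive constant. -/
def RegularOn (f : ℝ → ℝ) (T : Set ℝ) : Prop :=
  ∃ C : ℝ, 1 ≤ C ∧ ∀ t ∈ T, rearrAvg f t ≤ dominant f C t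

/-- If $f\ne0$, then $f^*(r)=\varepsilon>0$ for some $r$, and $Q\ge1/r$ makes
$f^*(t/Q)\ge\varepsilon$ for all $t\le1$; the additive 1 is then at most $\varepsilon^{-1}f^*(t/Q)$.
-/
theorem RegularOn.exists_le_mul (hf : Integrable f lam) {T : Set ℝ} (hT : T ⊆ Ioc 0 1)
    (h : RegularOn f T) :
    ∃ Q : ℝ, 1 < Q ∧ ∀ t ∈ T, rearrAvg f t ≤ Q * rearr f (Q⁻¹ * t) := by
  by_cases h0 : f =ᵐ[lam] 0
  · refine ⟨2, one_lt_two, fun t _ => ?_⟩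
    simp [rearrAvg, rearr_congr h0, rearr_zero]
  obtain ⟨r, hr, hpos⟩ := rearr_pos_of_not_ae_zero hf.aemeasurable h0
  obtain ⟨C, hC, hle⟩ := h
  set ε := rearr f r
  -- The two entries serve the multiplicative constant and the dilation; the final `+ 1` makes
  -- $Q>1$.
  set Q := max (C * (1 + ε⁻¹)) r⁻¹ + 1
  have hC0 : 0 < C := zero_lt_one.trans_le hC
  have hε : 0 < ε⁻¹ := inv_pos.2 hpos
  have hQ1 : C * (1 + ε⁻¹) ≤ Q := (le_max_left _ _).trans (le_add_of_nonneg_right zero_le_one)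
  have hQ2 : r⁻¹ ≤ Q := (le_max_right _ _).trans (le_add_of_nonneg_right zero_le_one)
  have hCQ : C ≤ Q := le_trans (by nlinarith) hQ1
  have hQ0 : 0 < Q := hC0.trans_le hCQ
  refine ⟨Q, lt_add_of_pos_left _ (lt_max_of_lt_right (inv_pos.2 hr.1)), fun t ht => ?_⟩
  have ht' := hT ht
  have hQt : 0 < Q⁻¹ * t := mul_pos (inv_pos.2 hQ0) ht'.1
  have h1 : rearr f (C⁻¹ * t) ≤ rearr f (Q⁻¹ * t) := rearr_anti hf.aemeasurable hQt
    (mul_le_mul_of_nonneg_right (inv_anti₀ hC0 hCQ) ht'.1.le)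
  have h2 : ε ≤ rearr f (Q⁻¹ * t) := by
    refine rearr_anti hf.aemeasurable hQt ?_
    calc Q⁻¹ * t ≤ Q⁻¹ := mul_le_of_le_one_right (inv_nonneg.2 hQ0.le) ht'.2
      _ ≤ r := inv_le_of_inv_le₀ hr.1 hQ2
  have h3 : 1 ≤ ε⁻¹ * rearr f (Q⁻¹ * t) := by
    rw [← inv_mul_cancel₀ hpos.ne']
    exact mul_le_mul_of_nonneg_left h2 hε.le
  calc rearrAvg f t ≤ C * (rearr f (C⁻¹ * t) + 1) := hle t ht
    _ ≤ C * (rearr f (Q⁻¹ * t) + ε⁻¹ * rearr f (Q⁻¹ * t)) :=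
      mul_le_mul_of_nonneg_left (add_le_add h1 h3) hC0.le
    _ = C * (1 + ε⁻¹) * rearr f (Q⁻¹ * t) := by ring
    _ ≤ Q * rearr f (Q⁻¹ * t) := mul_le_mul_of_nonneg_right hQ1 (rearr_nonneg _ _)

end Rearrangement

/-! ### Description of the principal symmetric ideal -/

section Principal

theorem aemeasurable_coeFn (x : L1I) : AEMeasurable x lam := (L1.integrable_coeFn x).aemeasurable

/-- The elements of `L¹(I)` whose rearrangement lies below some function `C (f*(t / C) + 1)`. -/
def dominated (f : L1I) : Submodule ℝ L1I where
  carrier := {x | ∃ C : ℝ, 1 ≤ C ∧ ∀ t ∈ Ioc (0 : ℝ) 1, rearr x t ≤ dominant f C t}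
  zero_mem' := by
    refine ⟨1, le_rfl, fun t _ => ?_⟩
    rw [rearr_congr (Lp.coeFn_zero ℝ 1 lam), rearr_zero]
    exact zero_le_one.trans (le_dominant zero_le_one)
  add_mem' := by
    rintro x y ⟨C, hC, hx⟩ ⟨D, hD, hy⟩
    have hM : 1 ≤ max C D := le_max_of_le_left hC
    have hM0 : 0 < max C D := zero_lt_one.trans_le hM
    refine ⟨2 * max C D, by linarith, fun t ht => ?_⟩
    have ht2 : t / 2 ∈ Ioc (0 : ℝ) 1 := ⟨half_pos ht.1, (half_lt_self ht.1).le.trans ht.2⟩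
    have hf := aemeasurable_coeFn f
    rw [rearr_congr (Lp.coeFn_add x y)]
    have h1 := rearr_add_le (aemeasurable_coeFn x) (aemeasurable_coeFn y) ht.1
    have h2 := (hx _ ht2).trans (dominant_mono hf ht2.1 hC (le_max_left C D))
    have h3 := (hy _ ht2).trans (dominant_mono hf ht2.1 hD (le_max_right C D))
    have h4 : dominant f (2 * max C D) t = 2 * dominant f (max C D) (t / 2) := by
      rw [dominant, dominant, show (2 * max C D)⁻¹ * t = (max C D)⁻¹ * (t / 2) by
        rw [mul_inv]; ring]
      ring
    refine h1.trans ?_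
    linarith
  smul_mem' := by
    rintro c x ⟨C, hC, hx⟩
    have hM : C ≤ C * (|c| + 1) :=
      le_mul_of_one_le_right (zero_le_one.trans hC) (le_add_of_nonneg_left (abs_nonneg c))
    have hc : 0 < |c| + 1 := add_pos_of_nonneg_of_pos (abs_nonneg c) one_pos
    -- The summand 1 keeps the factor positive when $c=0$.
    refine ⟨C * (|c| + 1), hC.trans hM, fun t ht => ?_⟩
    have h1 : rearr (c • x : L1I) t ≤ (|c| + 1) * rearr x t := by
      rw [rearr_congr (Lp.coeFn_smul c x)]
      refine rearr_le (mul_nonneg hc.le (rearr_nonneg _ _))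
        ((measure_mono fun y hy => ?_).trans (level_rearr_le (aemeasurable_coeFn x) ht.1))
      simp only [mem_ofPred_eq, Pi.smul_apply, smul_eq_mul, abs_mul] at hy ⊢
      refine lt_of_mul_lt_mul_left (hy.trans_le ?_) hc.le
      exact mul_le_mul_of_nonneg_right (by linarith) (abs_nonneg _)
    have h2 : rearr f (C⁻¹ * t) ≤ rearr f ((C * (|c| + 1))⁻¹ * t) := by
      have hC0 : 0 < C := zero_lt_one.trans_le hC
      exact rearr_anti (aemeasurable_coeFn f)
        (mul_pos (inv_pos.2 (hC0.trans_le hM)) ht.1)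
        (mul_le_mul_of_nonneg_right (inv_anti₀ hC0 hM) ht.1.le)
    calc rearr (c • x : L1I) t ≤ (|c| + 1) * rearr x t := h1
      _ ≤ (|c| + 1) * (C * (rearr f (C⁻¹ * t) + 1)) := mul_le_mul_of_nonneg_left (hx t ht) hc.le
      _ = C * (|c| + 1) * (rearr f (C⁻¹ * t) + 1) := by ring
      _ ≤ C * (|c| + 1) * (rearr f ((C * (|c| + 1))⁻¹ * t) + 1) :=
        mul_le_mul_of_nonneg_left (by linarith) (by linarith)

theorem isSymmetricIdeal_dominated (f : L1I) : IsSymmetricIdeal (dominated f) where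
  bounded_mem x hx := by
    obtain ⟨M, hM⟩ : ∃ M : ℝ, ∀ᵐ y ∂lam, ‖x y‖ ≤ M := by
      refine ⟨(eLpNorm x ⊤ lam).toReal, ?_⟩
      filter_upwards [ae_le_eLpNormEssSup (f := x) (μ := lam)] with y hy
      rw [← eLpNorm_exponent_top] at hy
      exact (ENNReal.ofReal_le_iff_le_toReal hx.2.ne).1 (by rwa [ofReal_norm])
    refine ⟨max M 1, le_max_right _ _, fun t ht => ?_⟩
    have hM0 : 0 ≤ max M 1 := zero_le_one.trans (le_max_right _ _)
    refine le_trans (rearr_le hM0 ?_) (le_dominant hM0)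
    refine le_of_eq_of_le ?_ zero_le
    refine measure_eq_zero_iff_ae_notMem.2 ?_
    filter_upwards [hM] with y hy
    exact not_lt.2 (hy.trans (le_max_left _ _))
  solid := by
    rintro x ⟨C, hC, hx⟩ y hyx
    refine ⟨C, hC, fun t ht => (rearr_mono (aemeasurable_coeFn x) ht.1 ?_).trans (hx t ht)⟩
    filter_upwards [(Lp.coeFn_le _ _).2 hyx, Lp.coeFn_abs x, Lp.coeFn_abs y] with z h1 h2 h3
    rwa [← h2, ← h3]
  symm_mem := by
    rintro x ⟨C, hC, hx⟩ y hyx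
    exact ⟨C, hC, fun t ht => (hyx t ht).trans (hx t ht)⟩

theorem self_mem_dominated (f : L1I) : f ∈ dominated f :=
  ⟨1, le_rfl, fun t _ => by simp [dominant]⟩

variable {X : Submodule ℝ L1I}

theorem IsSymmetricIdeal.mem_of_rearr_le (hX : IsSymmetricIdeal X) {x y : L1I} (hx : x ∈ X)
    (h : ∀ t ∈ Ioo (0 : ℝ) 1, rearr y t ≤ rearr x t) : y ∈ X := by
  refine hX.symm_mem x hx y fun t ht => ?_
  rcases ht.2.lt_or_eq with h1 | rfl
  · exact h t ⟨ht.1, h1⟩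
  · rw [rearr_one, rearr_one]

theorem IsSymmetricIdeal.toL1_mem (hX : IsSymmetricIdeal X) {x : L1I} (hx : x ∈ X) {g : ℝ → ℝ}
    (hg : AEMeasurable g lam) (h : ∀ t ∈ Ioo (0 : ℝ) 1, rearr g t ≤ rearr x t) :
    MemIdeal g X := by
  have hi := integrable_of_rearr_le (L1.integrable_coeFn x) hg h
  refine ⟨hi, hX.mem_of_rearr_le hx fun t ht => ?_⟩
  rw [rearr_congr hi.coeFn_toL1]
  exact h t ht

/-- The null point $x=1$ is dropped, since monotonicity of `rearr` is available only for positive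
arguments. -/
theorem aemeasurable_rearr_one_sub {f : ℝ → ℝ} (hf : AEMeasurable f lam) :
    AEMeasurable (fun x => rearr f (1 - x)) lam := by
  have h1 : AEMeasurable (fun x => rearr f (1 - x)) (volume.restrict (Iio (1 : ℝ))) :=
    aemeasurable_restrict_of_monotoneOn measurableSet_Iio fun x hx y hy hxy =>
      rearr_anti hf (sub_pos.2 hy) (by linarith)
  have h2 : volume.restrict (Ioo (0 : ℝ) 1) = lam :=
    Measure.restrict_congr_set Ioo_ae_eq_Ioc
  rw [← h2]
  exact h1.mono_measure (Measure.restrict_mono_set _ Ioo_subset_Iio_self)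

/-- In a symmetric ideal the rearrangement of an element may be dilated by the factor `2`:
`h*(t) + h*(1 - t)` rearranges to a function that exceeds `h*(t / 2)`. -/
theorem IsSymmetricIdeal.exists_dilation (hX : IsSymmetricIdeal X) {h : L1I} (hh : h ∈ X) :
    ∃ w ∈ X, ∀ t ∈ Ioo (0 : ℝ) 1, rearr h (t / 2) ≤ rearr w t := by
  have hm := aemeasurable_coeFn h
  obtain ⟨hu, hu'⟩ := hX.toL1_mem hh (aemeasurable_rearr hm) fun t ht => rearr_rearr_le hm ht.1
  have hvm := aemeasurable_rearr_one_sub hm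
  obtain ⟨hv, hv'⟩ := hX.toL1_mem (g := fun x => rearr h (1 - x)) hh hvm fun t ht => by
    refine rearr_le (rearr_nonneg _ _) ?_
    have hsub : {x | rearr h t < |rearr h (1 - x)|} ∩ Ioc (0 : ℝ) 1 ⊆ Ioc (1 - t) 1 := by
      rintro x ⟨hx, hx1⟩
      refine ⟨?_, hx1.2⟩
      by_contra hc
      rw [mem_ofPred_eq, abs_of_nonneg (rearr_nonneg _ _)] at hx
      exact absurd (rearr_anti hm ht.1 (by linarith : t ≤ 1 - x)) (not_le.2 hx)
    rw [Measure.restrict_apply' measurableSet_Ioc]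
    simpa using measure_mono (μ := volume) hsub
  refine ⟨_, X.add_mem hu' hv', fun t ht => ?_⟩
  have hw : (hu.toL1 _ + hv.toL1 _ : L1I) =ᵐ[lam] fun x => rearr h x + rearr h (1 - x) := by
    filter_upwards [Lp.coeFn_add (hu.toL1 _) (hv.toL1 _), hu.coeFn_toL1, hv.coeFn_toL1]
      with x h1 h2 h3
    rw [h1, Pi.add_apply, h2, h3]
  rw [rearr_congr hw]
  refine le_rearr_of_level (hu.add hv).aemeasurable ht.1 fun β hβ hlt => ?_
  have h1 := (lt_rearr_iff hm (half_pos ht.1) hβ).1 hlt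
  obtain ⟨s, hs0, hs1, hs2⟩ := ENNReal.lt_iff_exists_real_btwn.1 h1
  have hts : t / 2 < s := (ENNReal.ofReal_lt_ofReal_iff_of_nonneg (half_pos ht.1).le).1 hs1
  have hspos : 0 < s := (half_pos ht.1).trans hts
  have hβs : β < rearr h s := (lt_rearr_iff hm hspos hβ).2 hs2
  -- The cut at $1/2$ keeps $(0,r)$ and $(1-r,1)$ disjoint; together they have measure $2r>t$, and
  -- the sum exceeds $\beta$ on both.
  set r := min s (1 / 2) with hr
  have hr1 : t / 2 < r := lt_min hts (by linarith [ht.2])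
  have hr2 : r ≤ 1 / 2 := min_le_right _ _
  have hr0 : 0 < r := (half_pos ht.1).trans hr1
  have hβr : ∀ x, 0 < x → x ≤ r → β < rearr h x := fun x hx0 hx =>
    hβs.trans_le (rearr_anti hm hx0 (hx.trans (min_le_left _ _)))
  have hvol : ENNReal.ofReal t < lam (Ioo 0 r ∪ Ioo (1 - r) 1) := by
    rw [Measure.restrict_apply (measurableSet_Ioo.union measurableSet_Ioo), inter_eq_left.2,
      measure_union _ measurableSet_Ioo, Real.volume_Ioo, Real.volume_Ioo,
      ← ENNReal.ofReal_add (by linarith) (by linarith), ENNReal.ofReal_lt_ofReal_iff (by linarith)]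
    · linarith
    · rw [Set.disjoint_left]
      intro x hx hx'
      linarith [hx.2, hx'.1]
    · rintro x (hx | hx)
      · exact ⟨hx.1, by linarith [hx.2]⟩
      · exact ⟨by linarith [hx.1], hx.2.le⟩
  refine hvol.trans_le (measure_mono ?_)
  have hnn := rearr_nonneg h
  rintro x (hx | hx)
  · rw [mem_ofPred_eq, abs_of_nonneg (add_nonneg (hnn _) (hnn _))]
    exact (hβr x hx.1 hx.2.le).trans_le (le_add_of_nonneg_right (hnn _))
  · rw [mem_ofPred_eq, abs_of_nonneg (add_nonneg (hnn _) (hnn _))]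
    exact (hβr (1 - x) (by linarith [hx.2]) (by linarith [hx.1])).trans_le
      (le_add_of_nonneg_left (hnn _))

theorem IsSymmetricIdeal.mem_of_rearr_le_dilation (hX : IsSymmetricIdeal X) (k : ℕ) {h y : L1I}
    (hh : h ∈ X) (hy : ∀ t ∈ Ioo (0 : ℝ) 1, rearr y t ≤ rearr h (t / 2 ^ k)) : y ∈ X := by
  induction k generalizing h with
  | zero => exact hX.mem_of_rearr_le hh (by simpa using hy)
  | succ k ih =>
    obtain ⟨w, hw, hle⟩ := hX.exists_dilation hh
    refine ih hw fun t ht => (hy t ht).trans ?_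
    have h2 : (1 : ℝ) ≤ 2 ^ k := one_le_pow₀ one_le_two
    have := hle (t / 2 ^ k) ⟨div_pos ht.1 (by positivity), (div_le_self ht.1.le h2).trans_lt ht.2⟩
    rwa [div_div, ← pow_succ] at this

/-- The bound $C(f^*(t/C)+1)$ lies below the rearrangement of $C(|f|+1)\in X$ at $t/2^k$ once
$2^k>C$, so $k$ dilations by 2 suffice. -/
theorem dominated_le (hX : IsSymmetricIdeal X) {f : L1I} (hf : f ∈ X) : dominated f ≤ X := by
  rintro y ⟨C, hC, hy⟩
  have hC0 : 0 < C := zero_lt_one.trans_le hC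
  have hone : (memLp_const (1 : ℝ) : MemLp (fun _ : ℝ => (1 : ℝ)) 1 lam).toLp _ ∈ X :=
    hX.bounded_mem _ ((memLp_const (1 : ℝ)).ae_eq (MemLp.coeFn_toLp _).symm)
  set e : L1I := (memLp_const (1 : ℝ) : MemLp (fun _ : ℝ => (1 : ℝ)) 1 lam).toLp _
  have he : e =ᵐ[lam] fun _ => (1 : ℝ) := MemLp.coeFn_toLp _
  have habs : |f| ∈ X := hX.solid f hf _ (abs_abs f).le
  have hfm := aemeasurable_coeFn f
  obtain ⟨k, hk⟩ := pow_unbounded_of_one_lt C (one_lt_two (α := ℝ))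
  refine hX.mem_of_rearr_le_dilation k (X.smul_mem C (X.add_mem habs hone)) fun t ht => ?_
  have hs0 : 0 < t / 2 ^ k := div_pos ht.1 (by positivity)
  have hs1 : t / 2 ^ k < 1 := (div_le_self ht.1.le (one_le_pow₀ one_le_two)).trans_lt ht.2
  have hw : (C • (|f| + e) : L1I) =ᵐ[lam] fun x => C * (|f x| + 1) := by
    filter_upwards [Lp.coeFn_smul C (|f| + e), Lp.coeFn_add |f| e, Lp.coeFn_abs f, he]
      with x h1 h2 h3 h4
    rw [h1, Pi.smul_apply, h2, Pi.add_apply, h3, h4, smul_eq_mul]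
  rw [rearr_congr hw]
  have hts : t / 2 ^ k ≤ C⁻¹ * t := by
    rw [div_eq_inv_mul]
    exact mul_le_mul_of_nonneg_right (inv_anti₀ hC0 hk.le) ht.1.le
  have h1 : rearr y t ≤ C * (rearr f (t / 2 ^ k) + 1) := (hy t ⟨ht.1, ht.2.le⟩).trans
    (mul_le_mul_of_nonneg_left (by linarith [rearr_anti hfm hs0 hts]) hC0.le)
  refine h1.trans (le_rearr_of_level ?_ hs0 fun β hβ hlt => ?_)
  · exact (aemeasurable_coeFn (C • (|f| + e))).congr hw
  have hpos : ∀ x, |C * (|f x| + 1)| = C * (|f x| + 1) := fun x =>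
    abs_of_nonneg (mul_nonneg hC0.le (by positivity))
  simp only [hpos]
  by_cases hβC : β < C
  · have : {x | β < C * (|f x| + 1)} = univ := by
      refine eq_univ_of_forall fun x => ?_
      rw [mem_ofPred_eq]
      nlinarith [abs_nonneg (f x)]
    rw [this, measure_univ]
    simpa using hs1
  · have h2 : 0 ≤ β / C - 1 := by
      rw [sub_nonneg, le_div_iff₀ hC0]
      linarith
    have h3 : β / C - 1 < rearr f (t / 2 ^ k) := by
      rw [sub_lt_iff_lt_add, div_lt_iff₀ hC0]
      linarith
    refine ((lt_rearr_iff hfm hs0 h2).1 h3).trans_le (measure_mono fun x hx => ?_)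
    rw [mem_ofPred_eq, sub_lt_iff_lt_add, div_lt_iff₀ hC0] at hx
    rw [mem_ofPred_eq]
    linarith

theorem principal_eq_dominated (f : L1I) : principal f = dominated f :=
  le_antisymm ((principal_isLeast f).2 ⟨isSymmetricIdeal_dominated f, self_mem_dominated f⟩)
    (dominated_le (principal_isLeast f).1.1 (principal_isLeast f).1.2)

theorem mem_principal_iff {f x : L1I} : x ∈ principal f ↔
    ∃ C : ℝ, 1 ≤ C ∧ ∀ t ∈ Ioc (0 : ℝ) 1, rearr x t ≤ dominant f C t := by
  rw [principal_eq_dominated]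
  rfl

end Principal

/-! ### Sufficiency: averaging over monotonic partitions -/

theorem rearrAvg_le_of_rearr_le_dominant {f g : ℝ → ℝ} (hf : Integrable f lam)
    (hg : Integrable g lam) {C : ℝ} (hC : 1 ≤ C)
    (h : ∀ t ∈ Ioc (0 : ℝ) 1, rearr g t ≤ dominant f C t) {b : ℝ} (hb : b ∈ Ioc (0 : ℝ) 1) :
    rearrAvg g b ≤ C ^ 2 * (rearrAvg f b + 1) := by
  have hC0 : 0 < C := zero_lt_one.trans_le hC
  have hCb0 : 0 < C⁻¹ * b := mul_pos (inv_pos.2 hC0) hb.1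
  have hCb : C⁻¹ * b ≤ b := mul_le_of_le_one_left hb.1.le (inv_le_one_of_one_le₀ hC)
  have hi : IntervalIntegrable (fun x => rearr f (C⁻¹ * x)) volume 0 b := by
    have := (intervalIntegrable_rearr hf ⟨le_rfl, zero_le_one⟩
      ⟨hCb0.le, hCb.trans hb.2⟩).comp_mul_left (c := C⁻¹)
    rwa [zero_div, mul_div_cancel_left₀ _ (inv_pos.2 hC0).ne'] at this
  have h1 : ∫ x in (0 : ℝ)..b, rearr g x ≤ ∫ x in (0 : ℝ)..b, C * (rearr f (C⁻¹ * x) + 1) :=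
    intervalIntegral.integral_mono_on_of_le_Ioo hb.1.le
      (intervalIntegrable_rearr hg ⟨le_rfl, zero_le_one⟩ ⟨hb.1.le, hb.2⟩)
      ((hi.add intervalIntegrable_const).const_mul C)
      fun x hx => h x ⟨hx.1, hx.2.le.trans hb.2⟩
  rw [intervalIntegral.integral_const_mul, intervalIntegral.integral_add hi
    intervalIntegrable_const, intervalIntegral.integral_comp_mul_left _ (inv_pos.2 hC0).ne',
    mul_zero, inv_inv, intervalIntegral.integral_const, smul_eq_mul, smul_eq_mul, sub_zero,
    mul_one] at h1
  have h2 := integral_rearr_mono hf hCb0.le hCb hb.2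
  rw [← mul_rearrAvg g hb.1] at h1
  rw [← mul_rearrAvg f hb.1] at h2
  have h3 : C * b ≤ C ^ 2 * b := mul_le_mul_of_nonneg_right (by nlinarith) hb.1.le
  have h4 := mul_le_mul_of_nonneg_left h2 (sq_nonneg C)
  refine le_of_mul_le_mul_left ?_ hb.1
  nlinarith

namespace IntervalPartition

variable (B : IntervalPartition) {f : L1I}

theorem pt_mem (n : ℕ) : B.pt n ∈ Ioc (0 : ℝ) 1 := ⟨B.pt_pos n, B.pt_le_one n⟩

theorem range_pt_subset : range B.pt ⊆ Ioc 0 1 := by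
  rintro _ ⟨n, rfl⟩
  exact B.pt_mem n

theorem atom_subset (n : ℕ) : B.atom n ⊆ Ioc 0 1 :=
  Ioc_subset_Ioc (B.pt_pos _).le (B.pt_le_one _)

theorem lam_Ioc_pt (m n : ℕ) : lam (Ioc (B.pt m) (B.pt n)) = ENNReal.ofReal (B.pt n - B.pt m) := by
  rw [Measure.restrict_apply measurableSet_Ioc,
    inter_eq_left.2 (Ioc_subset_Ioc (B.pt_pos _).le (B.pt_le_one _)), Real.volume_Ioc]

theorem lam_atom (n : ℕ) : lam (B.atom n) = ENNReal.ofReal (B.len n) := B.lam_Ioc_pt _ _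

theorem exists_mem_atom {t : ℝ} (ht : t ∈ Ioc (0 : ℝ) 1) : ∃ n, t ∈ B.atom n := by
  classical
  have h : ∃ n, B.pt n < t := (B.tendsto.eventually_lt_const ht.1).exists
  obtain ⟨k, hk⟩ : ∃ k, Nat.find h = k + 1 := by
    refine Nat.exists_eq_succ_of_ne_zero fun h0 => ?_
    have := Nat.find_spec h
    rw [h0, B.pt_zero] at this
    exact absurd ht.2 (not_le.2 this)
  refine ⟨k, ?_, not_lt.1 (Nat.find_min h (by omega))⟩
  rw [← hk]
  exact Nat.find_spec h

theorem lt_succ_of_mem_atom {n : ℕ} {m : ℕ} {t : ℝ} (hn : t ∈ B.atom n) (hm : B.pt (m + 1) < t) :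
    n ≤ m :=
  Nat.lt_succ_iff.1 (B.strictAnti.lt_iff_gt.1 (hm.trans_le hn.2))

theorem eq_of_mem_atom {m n : ℕ} {t : ℝ} (hm : t ∈ B.atom m) (hn : t ∈ B.atom n) : m = n :=
  le_antisymm (B.lt_succ_of_mem_atom hm hn.1) (B.lt_succ_of_mem_atom hn hm.1)

/-- Sets of the generated σ-algebra cannot split an atom; hence functions measurable for it are
constant on atoms. -/
theorem mem_of_measurableSet_sigma {S : Set ℝ} (hS : MeasurableSet[B.sigma] S) {n : ℕ} {x y : ℝ}
    (hx : x ∈ B.atom n) (hy : y ∈ B.atom n) : x ∈ S ↔ y ∈ S := by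
  induction S, hS using MeasurableSpace.generateFrom_induction with
  | hC s hs _ =>
    obtain ⟨m, rfl⟩ := hs
    exact ⟨fun h => B.eq_of_mem_atom hx h ▸ hy, fun h => B.eq_of_mem_atom hy h ▸ hx⟩
  | empty => simp
  | compl s _ ih => simp only [mem_compl_iff, ih]
  | iUnion s _ ih => simp only [mem_iUnion, ih]

theorem expect_ae_eq (x : L1I) : B.expect x =ᵐ[lam] lam[x | B.sigma] :=
  Integrable.coeFn_toL1 _

theorem rearr_expect_le {x : L1I} (hB : B.IsMonotonic) {n : ℕ} {t : ℝ} (ht : t ∈ B.atom n) :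
    rearr (B.expect x) t ≤ 2 * rearrAvg x (B.pt n) := by
  have hx := L1.integrable_coeFn x
  have ht1 := B.atom_subset n ht
  rw [rearr_congr (B.expect_ae_eq x)]
  refine le_of_forall_gt_imp_ge_of_dense fun α hα => ?_
  have hα0 : 0 ≤ α := (mul_nonneg zero_le_two (rearrAvg_nonneg _ (B.pt_pos n).le)).trans hα.le
  refine rearr_le hα0 ?_
  by_contra hc
  set E : ℝ → ℝ := lam[x | B.sigma] with hE
  set S := {y | α < |E y|} with hSdef
  have hEm : StronglyMeasurable[B.sigma] E := stronglyMeasurable_condExp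
  have hS : MeasurableSet[B.sigma] S :=
    measurableSet_lt (mδ := B.sigma) measurable_const hEm.norm.measurable
  have hS' : MeasurableSet S := B.sigma_le _ hS
  have htS := not_le.1 hc
  set r := (lam S).toReal with hr
  have hrS : lam S = ENNReal.ofReal r := (ENNReal.ofReal_toReal (measure_ne_top _ _)).symm
  have htr : t < r := (ENNReal.ofReal_lt_iff_lt_toReal ht1.1.le (measure_ne_top _ _)).1 htS
  have hr0 : 0 < r := ht1.1.trans htr
  have hr1 : r ≤ 1 :=
    ENNReal.toReal_le_of_le_ofReal zero_le_one (by rw [ENNReal.ofReal_one]; exact prob_le_one)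
  -- $S$ has measure above $t>b_{n+1}$, so it cannot fit into $(0,b_{n+1}]$; it therefore contains a
  -- whole atom with index $m\le n$.
  obtain ⟨y, hyS, hy⟩ : ∃ y ∈ S, y ∈ Ioc (B.pt (n + 1)) 1 := by
    by_contra! hno
    have hsub : S ∩ Ioc (0 : ℝ) 1 ⊆ Ioc 0 (B.pt (n + 1)) := fun z hz =>
      ⟨hz.2.1, not_lt.1 fun h => hno z hz.1 ⟨h, hz.2.2⟩⟩
    have := measure_mono (μ := volume) hsub
    rw [← Measure.restrict_apply hS', Real.volume_Ioc, sub_zero, hrS,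
      ENNReal.ofReal_le_ofReal_iff (B.pt_pos _).le] at this
    linarith [ht.1]
  obtain ⟨m, hm⟩ := B.exists_mem_atom (t := y) ⟨(B.pt_pos _).trans hy.1, hy.2⟩
  have hmn : m ≤ n := B.lt_succ_of_mem_atom hm hy.1
  have hlen : B.len n ≤ r := by
    refine (hB hmn).trans ?_
    have hsub : B.atom m ⊆ S := fun z hz => (B.mem_of_measurableSet_sigma hS hm hz).1 hyS
    have := measure_mono (μ := lam) hsub
    rwa [lam_atom, hrS, ENNReal.ofReal_le_ofReal_iff hr0.le] at this
  -- $r$ dominates both $b_{n+1}$ and $b_n-b_{n+1}$, hence half their sum.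
  have hhalf : B.pt n / 2 ≤ r := by
    have : B.len n = B.pt n - B.pt (n + 1) := rfl
    linarith [ht.1]
  have h1 : α * r ≤ ∫ y in S, |E y| ∂lam := by
    have := setIntegral_mono_on (μ := lam) (f := fun _ => α) (g := fun y => |E y|) (s := S)
      (integrable_const α).integrableOn integrable_condExp.abs.integrableOn hS'
      fun y hy => le_of_lt hy
    rwa [setIntegral_const, smul_eq_mul, mul_comm] at this
  have h2 : ∫ y in S, |E y| ∂lam ≤ ∫ y in S, |x y| ∂lam := setIntegral_abs_condExp_le hS _
  have h3 : α * r ≤ r * rearrAvg x r := by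
    rw [mul_rearrAvg _ hr0]
    exact h1.trans (h2.trans (setIntegral_abs_le hx hS'))
  have h4 : α ≤ rearrAvg x r := le_of_mul_le_mul_left (by linarith) hr0
  have h5 := rearrAvg_anti hx (half_pos (B.pt_pos n)) hhalf hr1
  have h6 := rearrAvg_le_two_mul hx (half_pos (B.pt_pos n)) (half_le_self (B.pt_pos n).le)
    (by linarith) (B.pt_le_one n)
  linarith

theorem averages_of_regularOn (hB : B.IsMonotonic) (h : RegularOn f (range B.pt)) :
    B.Averages (principal f) := by
  intro x hx
  obtain ⟨C, hC, hxC⟩ := mem_principal_iff.1 hx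
  obtain ⟨D, hD, hfD⟩ := h
  have hC2 : 1 ≤ C ^ 2 := one_le_pow₀ hC
  -- One factor 2 comes from the conditional expectation, $C^2$ from passing to averages, and the
  -- other 2 from absorbing the additive 1.
  have hM : D ≤ 4 * C ^ 2 * D := le_mul_of_one_le_left (by linarith) (by linarith)
  have hD0 : 0 < D := by linarith
  have hfm := aemeasurable_coeFn f
  refine mem_principal_iff.2 ⟨4 * C ^ 2 * D, hD.trans hM, fun t ht => ?_⟩
  obtain ⟨n, hn⟩ := B.exists_mem_atom ht
  have h1 := B.rearr_expect_le (x := x) hB hn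
  have h2 := rearrAvg_le_of_rearr_le_dominant (L1.integrable_coeFn f) (L1.integrable_coeFn x) hC
    hxC (B.pt_mem n)
  have h3 := hfD _ ⟨n, rfl⟩
  have h4 : 1 ≤ dominant f D (B.pt n) := hD.trans (le_dominant (by linarith))
  have h5 : rearr f (D⁻¹ * B.pt n) ≤ rearr f ((4 * C ^ 2 * D)⁻¹ * t) :=
    rearr_anti hfm (mul_pos (inv_pos.2 (hD0.trans_le hM)) ht.1)
      (mul_le_mul (inv_anti₀ hD0 hM) hn.2 ht.1.le (inv_nonneg.2 hD0.le))
  calc rearr (B.expect x) t ≤ 2 * (C ^ 2 * (rearrAvg f (B.pt n) + 1)) := by linarith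
    _ ≤ 2 * (C ^ 2 * (dominant f D (B.pt n) + dominant f D (B.pt n))) := by gcongr
    _ = 4 * C ^ 2 * D * (rearr f (D⁻¹ * B.pt n) + 1) := by rw [dominant]; ring
    _ ≤ dominant f (4 * C ^ 2 * D) t := by rw [dominant]; gcongr

end IntervalPartition

/-! ### Necessity: compressed copies of the rearrangement on blocks of atoms -/

namespace IntervalPartition

variable (B : IntervalPartition) {f : L1I}

/-- The index of the atom that contains `t`. -/
def index (t : ℝ) : ℕ := open Classical in if h : ∃ n, t ∈ B.atom n then h.choose else 0

theorem index_eq {n : ℕ} {t : ℝ} (h : t ∈ B.atom n) : B.index t = n := by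
  have h' : ∃ n, t ∈ B.atom n := ⟨n, h⟩
  rw [index, dif_pos h']
  exact B.eq_of_mem_atom h'.choose_spec h

theorem iUnion_atom : ⋃ n, B.atom n = Ioc 0 1 :=
  (iUnion_subset B.atom_subset).antisymm fun _ ht => mem_iUnion.2 (B.exists_mem_atom ht)

theorem step_apply (g : ℝ → ℝ) {n : ℕ} {t : ℝ} (h : t ∈ B.atom n) : B.step g t = g (B.pt n) := by
  rw [step, tsum_eq_single n, indicator_of_mem h]
  intro m hm
  exact indicator_of_notMem (fun hm' => hm (B.eq_of_mem_atom hm' h)) _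

theorem expect_eq_on_atom (x : L1I) (n : ℕ) : ∀ᵐ t ∂lam, t ∈ B.atom n →
    B.expect x t = (B.len n)⁻¹ * ∫ s in B.atom n, x s ∂lam := by
  have hEm : StronglyMeasurable[B.sigma] (lam[x | B.sigma]) := stronglyMeasurable_condExp
  have hA : MeasurableSet[B.sigma] (B.atom n) :=
    MeasurableSpace.measurableSet_generateFrom ⟨n, rfl⟩
  have hmem : B.pt n ∈ B.atom n := ⟨B.strictAnti n.lt_succ_self, le_rfl⟩
  have hconst : ∀ t ∈ B.atom n, (lam[x | B.sigma]) t = (lam[x | B.sigma]) (B.pt n) := fun t ht =>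
    (B.mem_of_measurableSet_sigma
      (hEm.measurable (measurableSet_singleton ((lam[x | B.sigma]) (B.pt n)))) ht hmem).2 rfl
  have hint : ∫ s in B.atom n, (lam[x | B.sigma]) s ∂lam = ∫ s in B.atom n, x s ∂lam :=
    setIntegral_condExp B.sigma_le (L1.integrable_coeFn x) hA
  rw [setIntegral_congr_fun (B.sigma_le _ hA) hconst, setIntegral_const, Measure.real, B.lam_atom,
    ENNReal.toReal_ofReal (B.len_pos n).le, smul_eq_mul] at hint
  filter_upwards [B.expect_ae_eq x] with t ht htn
  rw [ht, hconst t htn, ← hint, inv_mul_cancel_left₀ (B.len_pos n).ne']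

/-- The partition with the points `b_{n(0)}, b_{n(1)}, …`. -/
def coarsen (n : ℕ → ℕ) (hn : StrictMono n) (h0 : n 0 = 0) : IntervalPartition where
  pt k := B.pt (n k)
  pt_zero := by rw [h0, B.pt_zero]
  strictAnti := B.strictAnti.comp_strictMono hn
  tendsto := B.tendsto.comp hn.tendsto_atTop

/-- The index of the atom of `coarsen` that contains the `m`-th atom. -/
abbrev blockIndex (n : ℕ → ℕ) (hn : StrictMono n) (h0 : n 0 = 0) (m : ℕ) : ℕ :=
  (B.coarsen n hn h0).index (B.pt m)

/-- The ratio of the length of the `k`-th block to that of the `m`-th atom. -/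
def ratio (n : ℕ → ℕ) (k m : ℕ) : ℝ := (B.pt (n k) - B.pt (n (k + 1))) / B.len m

theorem ratio_pos (n : ℕ → ℕ) (hn : StrictMono n) (k m : ℕ) : 0 < B.ratio n k m :=
  div_pos (sub_pos.2 (B.strictAnti (hn k.lt_succ_self))) (B.len_pos m)

/-- The increasing affine map from the `m`-th atom onto the `k`-th block. -/
def stretch (n : ℕ → ℕ) (k m : ℕ) (x : ℝ) : ℝ :=
  B.ratio n k m * x + (B.pt (n (k + 1)) - B.ratio n k m * B.pt (m + 1))

theorem lt_stretch (n : ℕ → ℕ) (hn : StrictMono n) {k m : ℕ} {x : ℝ} (hx : B.pt (m + 1) < x) :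
    B.pt (n (k + 1)) < B.stretch n k m x := by
  have := mul_lt_mul_of_pos_left hx (B.ratio_pos n hn k m)
  rw [stretch]
  linarith

section Copy

variable (n : ℕ → ℕ) (hn : StrictMono n) (h0 : n 0 = 0)

theorem blockIndex_eq {k m : ℕ} (h1 : n k ≤ m) (h2 : m < n (k + 1)) :
    B.blockIndex n hn h0 m = k :=
  (B.coarsen n hn h0).index_eq ⟨B.strictAnti h2, B.strictAnti.antitone h1⟩

theorem blockIndex_spec (m : ℕ) : n (B.blockIndex n hn h0 m) ≤ m ∧
    m < n (B.blockIndex n hn h0 m + 1) := by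
  obtain ⟨k, hk⟩ := (B.coarsen n hn h0).exists_mem_atom (B.pt_mem m)
  rw [blockIndex, (B.coarsen n hn h0).index_eq hk]
  exact ⟨B.strictAnti.le_iff_ge.1 hk.2, B.strictAnti.lt_iff_gt.1 hk.1⟩

/-- On every atom, the function `g` restricted to the surrounding block, compressed affinely. -/
def copy (g : ℝ → ℝ) (x : ℝ) : ℝ :=
  g (B.stretch n (B.blockIndex n hn h0 (B.index x)) (B.index x) x)

theorem copy_apply (g : ℝ → ℝ) {m : ℕ} {x : ℝ} (hx : x ∈ B.atom m) :
    B.copy n hn h0 g x = g (B.stretch n (B.blockIndex n hn h0 m) m x) := by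
  rw [copy, B.index_eq hx]

theorem aemeasurable_copy (f : L1I) : AEMeasurable (B.copy n hn h0 (rearr f)) lam := by
  change AEMeasurable _ (volume.restrict (Ioc 0 1))
  rw [← B.iUnion_atom, aemeasurable_iUnion_iff]
  refine fun m => aemeasurable_restrict_of_antitoneOn measurableSet_Ioc fun x hx y hy hxy => ?_
  rw [B.copy_apply n hn h0 _ hx, B.copy_apply n hn h0 _ hy]
  refine rearr_anti (aemeasurable_coeFn f) ((B.pt_pos _).trans (B.lt_stretch n hn hx.1)) ?_
  have := mul_le_mul_of_nonneg_left hxy (B.ratio_pos n hn (B.blockIndex n hn h0 m) m).le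
  rw [stretch, stretch]
  linarith

theorem sum_len_Ico {p q : ℕ} (hpq : p ≤ q) :
    ∑ m ∈ Finset.Ico p q, B.len m = B.pt p - B.pt q := by
  induction q, hpq using Nat.le_induction with
  | base => simp
  | succ q hq ih =>
    rw [Finset.sum_Ico_succ_top hq, ih, len]
    ring

/-- Let $t$ lie in the block $(q,p]$. The copy can exceed $f^*(t)$ anywhere in $(0,q]$, on a
fraction at most $(t-q)/(p-q)$ of each atom of the block, and nowhere to the right of $p$, where
$f^*$ is evaluated beyond $p\ge t$. The total is at most $t$. -/
theorem rearr_copy_le (f : L1I) {t : ℝ} (ht : t ∈ Ioc (0 : ℝ) 1) :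
    rearr (B.copy n hn h0 (rearr f)) t ≤ rearr f t := by
  have hfm := aemeasurable_coeFn f
  obtain ⟨k, hk⟩ := (B.coarsen n hn h0).exists_mem_atom ht
  set p := B.pt (n k)
  set q := B.pt (n (k + 1))
  have hq : q < t := hk.1
  have hp : t ≤ p := hk.2
  have hqp : 0 < p - q := by linarith
  refine rearr_le (rearr_nonneg _ _) ?_
  have hsub : {x | rearr f t < |B.copy n hn h0 (rearr f) x|} ∩ Ioc (0 : ℝ) 1 ⊆
      Ioc 0 q ∪ ⋃ m ∈ Finset.Ico (n k) (n (k + 1)),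
        Ioc (B.pt (m + 1)) (B.pt (m + 1) + (t - q) / (p - q) * B.len m) := by
    rintro x ⟨hx, hx1⟩
    obtain ⟨m, hm⟩ := B.exists_mem_atom hx1
    rw [mem_ofPred_eq, B.copy_apply n hn h0 _ hm, abs_of_nonneg (rearr_nonneg _ _)] at hx
    have hlt : B.stretch n (B.blockIndex n hn h0 m) m x < t := by
      by_contra hc
      exact absurd (rearr_anti hfm ht.1 (not_lt.1 hc)) (not_le.2 hx)
    rcases le_or_gt (n (k + 1)) m with h2 | h2
    · exact Or.inl ⟨hx1.1, hm.2.trans (B.strictAnti.antitone h2)⟩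
    rcases le_or_gt (n k) m with h1 | h1
    · refine Or.inr (mem_iUnion₂.2 ⟨m, Finset.mem_Ico.2 ⟨h1, h2⟩, hm.1, ?_⟩)
      rw [B.blockIndex_eq n hn h0 h1 h2] at hlt
      have hlen := B.len_pos m
      have h3 : B.ratio n k m * (x - B.pt (m + 1)) < t - q := by
        rw [stretch] at hlt
        linarith
      have h4 : B.ratio n k m = (p - q) / B.len m := rfl
      rw [h4, div_mul_eq_mul_div, div_lt_iff₀ hlen] at h3
      have h5 : x - B.pt (m + 1) ≤ (t - q) / (p - q) * B.len m := by
        rw [div_mul_eq_mul_div, le_div_iff₀ hqp]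
        linarith
      linarith
    · exfalso
      have h3 := B.lt_stretch n hn (k := B.blockIndex n hn h0 m) hm.1
      have h4 : B.blockIndex n hn h0 m + 1 ≤ k := by
        have := (B.blockIndex_spec n hn h0 m).1.trans_lt h1
        exact hn.lt_iff_lt.1 this
      have h5 : p ≤ B.pt (n (B.blockIndex n hn h0 m + 1)) :=
        B.strictAnti.antitone (hn.monotone h4)
      linarith
  rw [Measure.restrict_apply' measurableSet_Ioc]
  refine (measure_mono hsub).trans ((measure_union_le _ _).trans ?_)
  have hc : 0 ≤ (t - q) / (p - q) := div_nonneg (by linarith) hqp.le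
  have h1 : volume (⋃ m ∈ Finset.Ico (n k) (n (k + 1)),
      Ioc (B.pt (m + 1)) (B.pt (m + 1) + (t - q) / (p - q) * B.len m)) ≤
      ENNReal.ofReal (t - q) := by
    refine (measure_biUnion_finset_le _ _).trans ?_
    simp only [Real.volume_Ioc, add_sub_cancel_left]
    rw [← ENNReal.ofReal_sum_of_nonneg fun m _ => mul_nonneg hc (B.len_pos m).le,
      ← Finset.mul_sum, B.sum_len_Ico (hn.monotone k.le_succ), div_mul_cancel₀ _ hqp.ne']
  refine (add_le_add_right h1 _).trans ?_
  rw [Real.volume_Ioc, sub_zero, ← ENNReal.ofReal_add (B.pt_pos _).le (by linarith),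
    add_sub_cancel]

theorem integral_copy (g : ℝ → ℝ) {k m : ℕ} (h1 : n k ≤ m) (h2 : m < n (k + 1)) :
    (B.len m)⁻¹ * ∫ x in B.atom m, B.copy n hn h0 g x ∂lam =
      (B.pt (n k) - B.pt (n (k + 1)))⁻¹ * ∫ x in B.pt (n (k + 1))..B.pt (n k), g x := by
  have hr := B.ratio_pos n hn k m
  have hl := B.len_pos m
  have hA : MeasurableSet (B.atom m) := measurableSet_Ioc
  have h3 : ∫ x in B.atom m, B.copy n hn h0 g x ∂lam =
      ∫ x in B.atom m, g (B.stretch n k m x) := by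
    rw [Measure.restrict_restrict hA, inter_eq_left.2 (B.atom_subset m)]
    refine setIntegral_congr_fun hA fun x hx => ?_
    rw [B.copy_apply n hn h0 g hx, B.blockIndex_eq n hn h0 h1 h2]
  rw [h3, atom, ← intervalIntegral.integral_of_le (B.strictAnti m.lt_succ_self).le]
  simp only [stretch]
  rw [intervalIntegral.integral_comp_mul_add _ hr.ne', smul_eq_mul]
  have h4 : B.ratio n k m * B.pt m + (B.pt (n (k + 1)) - B.ratio n k m * B.pt (m + 1)) =
      B.pt (n k) := by
    have : B.ratio n k m * (B.pt m - B.pt (m + 1)) = B.pt (n k) - B.pt (n (k + 1)) :=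
      div_mul_cancel₀ _ hl.ne'
    linarith
  rw [h4, add_sub_cancel, ← mul_assoc]
  congr 1
  rw [ratio, ← mul_inv, mul_div_cancel₀ _ hl.ne']

end Copy

/-- The recursion step for the block ends. Halving the point makes a block occupy at least half of
$(0,b_N]$; halving the integral leaves at least half the mass of $f^*$ in it. -/
theorem exists_block_end (hf : ¬ RegularOn f (range B.pt)) (k N : ℕ) : ∃ n, N < n ∧
    dominant f (k + 1) (B.pt n) < rearrAvg f (B.pt n) ∧ B.pt n ≤ B.pt N / 2 ∧
    2 * ∫ x in (0 : ℝ)..B.pt n, rearr f x ≤ ∫ x in (0 : ℝ)..B.pt N, rearr f x := by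
  have hfi := L1.integrable_coeFn f
  have hlarge : ∀ C : ℝ, 1 ≤ C → ∃ n, dominant f C (B.pt n) < rearrAvg f (B.pt n) := by
    intro C hC
    by_contra! h
    exact hf ⟨C, hC, by rintro _ ⟨n, rfl⟩; exact h n⟩
  have hpos : 0 < ∫ x in (0 : ℝ)..B.pt N, rearr f x := by
    obtain ⟨n, hn⟩ := hlarge 1 le_rfl
    have h1 : 0 < rearrAvg f (B.pt n) :=
      (zero_lt_one.trans_le (le_dominant zero_le_one)).trans hn
    rcases le_total N n with h | h
    · refine lt_of_lt_of_le ?_ (integral_rearr_mono hfi (B.pt_pos n).le (B.strictAnti.antitone h)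
        (B.pt_le_one N))
      rw [← mul_rearrAvg _ (B.pt_pos n)]
      exact mul_pos (B.pt_pos n) h1
    · rw [← mul_rearrAvg _ (B.pt_pos N)]
      exact mul_pos (B.pt_pos N) (h1.trans_le
        (rearrAvg_anti hfi (B.pt_pos N) (B.strictAnti.antitone h) (B.pt_le_one n)))
  have hlim : Tendsto (fun n => ∫ x in (0 : ℝ)..B.pt n, rearr f x) atTop (𝓝 0) := by
    have hc : ContinuousOn (fun b => ∫ x in (0 : ℝ)..b, rearr f x) (uIcc 0 1) :=
      intervalIntegral.continuousOn_primitive_interval'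
        (intervalIntegrable_rearr hfi ⟨le_rfl, zero_le_one⟩ ⟨zero_le_one, le_rfl⟩) left_mem_uIcc
    have h1 := (hc 0 left_mem_uIcc).tendsto
    rw [intervalIntegral.integral_same] at h1
    refine h1.comp (tendsto_nhdsWithin_iff.2 ⟨B.tendsto, Eventually.of_forall fun n => ?_⟩)
    rw [uIcc_of_le zero_le_one]
    exact ⟨(B.pt_pos n).le, B.pt_le_one n⟩
  obtain ⟨M, hM⟩ := eventually_atTop.1 (((eventually_gt_atTop N).and
    (B.tendsto.eventually_lt_const (half_pos (B.pt_pos N)))).and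
    (hlim.eventually_lt_const (half_pos hpos)))
  -- A constant at least $f^{**}(b_M)$ forces $n\ge M$, since $f^{**}(b_n)\le f^{**}(b_M)$ for
  -- smaller $n$.
  obtain ⟨n, hn⟩ := hlarge (max (k + 1) (rearrAvg f (B.pt M))) (le_max_of_le_left (by simp))
  have hMn : M ≤ n := by
    by_contra hc
    have h1 := rearrAvg_anti hfi (B.pt_pos M) (B.strictAnti.antitone (not_le.1 hc).le)
      (B.pt_le_one n)
    have h2 := le_dominant (f := f) (t := B.pt n)
      (le_max_of_le_right (rearrAvg_nonneg f (B.pt_pos M).le) :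
        0 ≤ max ((k : ℝ) + 1) (rearrAvg f (B.pt M)))
    linarith [le_max_right ((k : ℝ) + 1) (rearrAvg f (B.pt M))]
  obtain ⟨⟨h1, h2⟩, h3⟩ := hM n hMn
  refine ⟨n, h1, lt_of_le_of_lt ?_ hn, h2.le, by linarith⟩
  exact dominant_mono (aemeasurable_coeFn f) (B.pt_pos n) (by simp) (le_max_left _ _)

theorem regularOn_of_averages (h : B.Averages (principal f)) : RegularOn f (range B.pt) := by
  by_contra hf
  have hfi := L1.integrable_coeFn f
  choose F hF using B.exists_block_end hf
  set n : ℕ → ℕ := fun k => Nat.rec 0 F k with hndef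
  have hsucc : ∀ k, n (k + 1) = F k (n k) := fun k => rfl
  have hn : StrictMono n := strictMono_nat_of_lt_succ fun k => (hF k (n k)).1
  have h0 : n 0 = 0 := rfl
  obtain ⟨hi, hmem⟩ := (principal_isLeast f).1.1.toL1_mem (principal_isLeast f).1.2
    (B.aemeasurable_copy n hn h0 f) fun t ht => B.rearr_copy_le n hn h0 f ⟨ht.1, ht.2.le⟩
  obtain ⟨C, hC, hdom⟩ := mem_principal_iff.1 (h _ hmem)
  set E := B.expect (hi.toL1 _) with hE
  have hval : ∀ k, ∀ᵐ t ∂lam, t ∈ Ioc (B.pt (n (k + 1))) (B.pt (n k)) →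
      rearrAvg f (B.pt (n k)) / 2 ≤ E t := by
    intro k
    have hall := ae_all_iff.2 fun m => B.expect_eq_on_atom (hi.toL1 _) m
    filter_upwards [hall] with t ht htk
    obtain ⟨m, hm⟩ := B.exists_mem_atom
      ⟨(B.pt_pos _).trans htk.1, htk.2.trans (B.pt_le_one _)⟩
    have h1 : n k ≤ m := Nat.lt_succ_iff.1 (B.strictAnti.lt_iff_gt.1 (hm.1.trans_le htk.2))
    have h2 : m < n (k + 1) := B.strictAnti.lt_iff_gt.1 (htk.1.trans_le hm.2)
    have h3 : ∫ s in B.atom m, (hi.toL1 _ : L1I) s ∂lam =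
        ∫ s in B.atom m, B.copy n hn h0 (rearr f) s ∂lam :=
      integral_congr_ae (ae_restrict_of_ae hi.coeFn_toL1)
    rw [hE, ht m hm, h3, B.integral_copy n hn h0 _ h1 h2]
    have hpos := B.pt_pos (n k)
    have hpos' := B.pt_pos (n (k + 1))
    have hlt : B.pt (n (k + 1)) < B.pt (n k) := B.strictAnti (hn k.lt_succ_self)
    have h4 := intervalIntegral.integral_add_adjacent_intervals
      (intervalIntegrable_rearr hfi ⟨le_rfl, zero_le_one⟩ ⟨hpos'.le, B.pt_le_one _⟩)
      (intervalIntegrable_rearr hfi ⟨hpos'.le, B.pt_le_one _⟩ ⟨hpos.le, B.pt_le_one (n k)⟩)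
    have h5 := (hF k (n k)).2.2.2
    rw [← hsucc] at h5
    rw [inv_mul_eq_div, le_div_iff₀ (sub_pos.2 hlt)]
    have h6 := mul_rearrAvg f hpos
    have h7 := mul_nonneg (rearrAvg_nonneg f hpos.le) hpos'.le
    linarith
  -- The block has length at least $b_{n_k}/2$; evaluating at a quarter gives the strict inequality
  -- that `le_rearr_of_level` requires.
  have hrearr : ∀ k, rearrAvg f (B.pt (n k)) / 2 ≤ rearr E (B.pt (n k) / 4) := by
    intro k
    have hpos := B.pt_pos (n k)
    refine le_rearr_of_level (aemeasurable_coeFn E) (by linarith) fun β hβ hlt => ?_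
    have hhalf := (hF k (n k)).2.2.1
    rw [← hsucc] at hhalf
    refine lt_of_lt_of_le ?_ (measure_mono_ae (s := Ioc (B.pt (n (k + 1))) (B.pt (n k))) ?_)
    · rw [lam_Ioc_pt, ENNReal.ofReal_lt_ofReal_iff (by linarith)]
      linarith
    · filter_upwards [hval k] with t ht htk
      exact (hlt.trans_le (ht htk)).trans_le (le_abs_self _)
  -- At $b=b_{n_{k+1}}$ membership gives $f^{**}(b)/2\le\frac14$`dominant f (4 * C) b`, whereas the
  -- choice of $b$ makes $f^{**}(b)$ exceed `dominant f (k + 1) b`.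
  obtain ⟨k, hk⟩ := exists_nat_ge (4 * C)
  have hpos := B.pt_pos (n (k + 1))
  have h1 := (hrearr (k + 1)).trans (hdom _ ⟨by linarith, by linarith [B.pt_le_one (n (k + 1))]⟩)
  have h2 := (hF k (n k)).2.1
  rw [← hsucc] at h2
  have h3 : dominant f (4 * C) (B.pt (n (k + 1))) = 4 * dominant f C (B.pt (n (k + 1)) / 4) := by
    rw [dominant, dominant, show (4 * C)⁻¹ * B.pt (n (k + 1)) = C⁻¹ * (B.pt (n (k + 1)) / 4) by
      rw [mul_inv]; ring]
    ring
  have h4 : dominant f (4 * C) (B.pt (n (k + 1))) ≤ dominant f (k + 1) (B.pt (n (k + 1))) :=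
    dominant_mono (aemeasurable_coeFn f) hpos (by linarith) (by linarith)
  have h5 : 0 ≤ dominant f C (B.pt (n (k + 1)) / 4) :=
    (zero_le_one.trans hC).trans (le_dominant (zero_le_one.trans hC))
  linarith

end IntervalPartition

/-! ### Stability of the regularity condition -/

theorem RegularOn.of_le_mul {f : ℝ → ℝ} (hf : AEMeasurable f lam) {T : Set ℝ} (hT : T ⊆ Ioi 0)
    {C Q : ℝ} (hQ : 1 ≤ Q) (h : ∀ t ∈ T, rearrAvg f t ≤ C * rearr f (Q⁻¹ * t)) :
    RegularOn f T := by
  refine ⟨max Q C, le_max_of_le_left hQ, fun t ht => ?_⟩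
  have hQ0 : 0 < Q := zero_lt_one.trans_le hQ
  have hM : 0 < max Q C := lt_max_of_lt_left hQ0
  have h1 : rearr f (Q⁻¹ * t) ≤ rearr f ((max Q C)⁻¹ * t) :=
    rearr_anti hf (mul_pos (inv_pos.2 hM) (hT ht))
      (mul_le_mul_of_nonneg_right (inv_anti₀ hQ0 (le_max_left _ _)) (le_of_lt (hT ht)))
  exact (h t ht).trans (mul_le_mul (le_max_right _ _) (h1.trans (le_add_of_nonneg_right zero_le_one))
    (rearr_nonneg _ _) hM.le)

/-- Bridges the gap between $n\ge1$ in (1) and all points: a single value is absorbed by the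
constant. -/
theorem RegularOn.insert_one {f : ℝ → ℝ} (hf : AEMeasurable f lam) {T : Set ℝ} (hT : T ⊆ Ioi 0)
    (h : RegularOn f T) : RegularOn f (insert 1 T) := by
  obtain ⟨C, hC, hle⟩ := h
  have hM : 0 ≤ max C (rearrAvg f 1) := zero_le_one.trans (le_max_of_le_left hC)
  refine ⟨max C (rearrAvg f 1), le_max_of_le_left hC, ?_⟩
  rintro t (rfl | ht)
  · exact (le_max_right _ _).trans (le_dominant hM)
  · exact (hle t ht).trans (dominant_mono hf (hT ht) hC (le_max_left _ _))

theorem RegularOn.mono {f : ℝ → ℝ} {S T : Set ℝ} (h : RegularOn f T) (hST : S ⊆ T) :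
    RegularOn f S :=
  h.imp fun _ hC => ⟨hC.1, fun t ht => hC.2 t (hST ht)⟩

/-- The regularity condition passes to points that are comparable with the given ones. -/
theorem RegularOn.of_comparable {f : ℝ → ℝ} (hf : Integrable f lam) {S T : Set ℝ}
    (hS : S ⊆ Ioc 0 1) (hT : T ⊆ Ioc 0 1) (h : RegularOn f T)
    (hST : ∀ s ∈ S, ∃ t ∈ T, t ≤ 2 * s ∧ s ≤ 2 * t) : RegularOn f S := by
  obtain ⟨Q, hQ, hle⟩ := h.exists_le_mul hf hT
  have hQ0 : 0 < Q := zero_lt_one.trans hQ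
  refine RegularOn.of_le_mul hf.aemeasurable (C := 2 * Q) (Q := 2 * Q)
    (fun s hs => (hS hs).1) (by linarith) fun s hs => ?_
  obtain ⟨t, ht, hts, hst⟩ := hST s hs
  have hs' := hS hs
  have ht' := hT ht
  have h1 : rearrAvg f s ≤ 2 * rearrAvg f t := by
    rcases le_total s t with hl | hl
    · exact rearrAvg_le_two_mul hf hs'.1 hl hts ht'.2
    · exact (rearrAvg_anti hf ht'.1 hl hs'.2).trans
        (le_mul_of_one_le_left (rearrAvg_nonneg f ht'.1.le) one_le_two)
  have h2 : rearr f (Q⁻¹ * t) ≤ rearr f ((2 * Q)⁻¹ * s) := by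
    refine rearr_anti hf.aemeasurable (mul_pos (inv_pos.2 (by linarith)) hs'.1) ?_
    rw [mul_inv, show (2 : ℝ)⁻¹ * Q⁻¹ * s = Q⁻¹ * (s / 2) by ring]
    exact mul_le_mul_of_nonneg_left (by linarith) (inv_nonneg.2 hQ0.le)
  calc rearrAvg f s ≤ 2 * (Q * rearr f (Q⁻¹ * t)) := h1.trans (by linarith [hle t ht])
    _ ≤ 2 * (Q * rearr f ((2 * Q)⁻¹ * s)) := by gcongr
    _ = 2 * Q * rearr f ((2 * Q)⁻¹ * s) := by ring

/-- A non-increasing rearrangement of a non-increasing sequence is that sequence. -/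
theorem eq_of_antitone_perm {u v : ℕ → ℝ} (hu : Antitone u) (hv : Antitone v)
    (σ : Equiv.Perm ℕ) (h : ∀ n, v n = u (σ n)) : v = u := by
  have key : ∀ (u v : ℕ → ℝ), Antitone u → Antitone v → ∀ σ : Equiv.Perm ℕ,
      (∀ n, v n = u (σ n)) → ∀ n, v n ≤ u n := by
    intro u v hu hv σ h n
    -- Pigeonhole: $\sigma$ cannot map $\{0,\dots,n\}$ into $\{0,\dots,n-1\}$.
    obtain ⟨i, hi, hσ⟩ : ∃ i ≤ n, n ≤ σ i := by
      by_contra! hc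
      have := Finset.card_le_card_of_injOn (s := Finset.range (n + 1)) (t := Finset.range n) σ
        (fun i hi => by
          simp only [Finset.coe_range, mem_Iio] at hi ⊢
          exact hc i (by omega)) σ.injective.injOn
      simp at this
    exact (hv hi).trans ((h i).le.trans (hu hσ))
  refine funext fun n => le_antisymm (key u v hu hv σ h n) (key v u hv hu σ.symm (fun m => ?_) n)
  rw [h, σ.apply_symm_apply]

/-! ### Equivalent forms of regularity -/

namespace IntervalPartition

variable (B : IntervalPartition) {f : L1I}

theorem pt_eq_one_sub_sum (n : ℕ) : B.pt n = 1 - ∑ i ∈ Finset.range n, B.len i := by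
  induction n with
  | zero => simp [B.pt_zero]
  | succ n ih =>
    rw [Finset.sum_range_succ, len]
    linarith

theorem star_pt_eq (hB : B.IsMonotonic) : B.star.pt = B.pt := by
  obtain ⟨σ, hσ⟩ := B.star_len
  funext n
  rw [pt_eq_one_sub_sum, pt_eq_one_sub_sum, eq_of_antitone_perm hB B.star_isMonotonic σ hσ]

theorem averages_iff (hB : B.IsMonotonic) :
    B.Averages (principal f) ↔ RegularOn f (range B.pt) :=
  ⟨B.regularOn_of_averages, B.averages_of_regularOn hB⟩

theorem regularOn_range_iff : RegularOn f (range B.pt) ↔ ∃ Q : ℝ, 1 < Q ∧ ∀ n : ℕ, 1 ≤ n →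
    rearrAvg f (B.pt n) ≤ Q * rearr f (Q⁻¹ * B.pt n) := by
  constructor
  · intro h
    obtain ⟨Q, hQ, hle⟩ := h.exists_le_mul (L1.integrable_coeFn f) B.range_pt_subset
    exact ⟨Q, hQ, fun n _ => hle _ ⟨n, rfl⟩⟩
  · rintro ⟨Q, hQ, hle⟩
    have hfm := aemeasurable_coeFn f
    have hpos : B.pt '' Ici 1 ⊆ Ioi 0 := by
      rintro _ ⟨n, -, rfl⟩
      exact B.pt_pos n
    have h1 : RegularOn f (B.pt '' Ici 1) := by
      refine RegularOn.of_le_mul hfm hpos (C := Q) hQ.le ?_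
      rintro _ ⟨n, hn, rfl⟩
      exact hle n hn
    refine (h1.insert_one hfm hpos).mono ?_
    rintro _ ⟨n, rfl⟩
    rcases n.eq_zero_or_pos with rfl | hn
    · exact Or.inl B.pt_zero
    · exact Or.inr ⟨n, hn, rfl⟩

theorem dil_rearr_apply {Q : ℝ} (hQ : 1 ≤ Q) (g : ℝ → ℝ) (n : ℕ) :
    dil Q⁻¹ g (B.pt n) = g (Q⁻¹ * B.pt n) := by
  have hQ0 : 0 < Q⁻¹ := inv_pos.2 (zero_lt_one.trans_le hQ)
  exact if_pos ⟨mul_pos hQ0 (B.pt_pos n),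
    mul_le_one₀ (inv_le_one_of_one_le₀ hQ) (B.pt_pos n).le (B.pt_le_one n)⟩

/-- Every atom has positive measure, so an a.e. inequality between step functions holds on each
atom. -/
theorem funEquiv_step_iff (g h : ℝ → ℝ) : FunEquiv (B.step g) (B.step h) ↔
    ∃ C : ℝ, 1 ≤ C ∧ ∀ n, C⁻¹ * h (B.pt n) ≤ g (B.pt n) ∧ g (B.pt n) ≤ C * h (B.pt n) := by
  refine exists_congr fun C => and_congr_right fun _ => ⟨fun H n => ?_, fun H => ?_⟩
  · have hpos : lam (B.atom n) ≠ 0 := by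
      rw [lam_atom]
      exact (ENNReal.ofReal_pos.2 (B.len_pos n)).ne'
    obtain ⟨t, htn, ht⟩ := ((frequently_ae_mem_iff.2 hpos).and_eventually H).exists
    rwa [B.step_apply g htn, B.step_apply h htn] at ht
  · refine (ae_restrict_iff' measurableSet_Ioc).2 (Eventually.of_forall fun t ht => ?_)
    obtain ⟨n, hn⟩ := B.exists_mem_atom ht
    rw [B.step_apply g hn, B.step_apply h hn]
    exact H n

theorem regularOn_iff_funEquiv : RegularOn f (range B.pt) ↔ ∃ Q : ℝ, 1 < Q ∧
    FunEquiv (B.step (rearrAvg f)) (B.step (dil Q⁻¹ (rearr f))) := by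
  have hfi := L1.integrable_coeFn f
  simp only [funEquiv_step_iff]
  constructor
  · intro h
    obtain ⟨Q, hQ, hle⟩ := h.exists_le_mul hfi B.range_pt_subset
    refine ⟨Q, hQ, Q, hQ.le, fun n => ?_⟩
    rw [B.dil_rearr_apply hQ.le]
    exact ⟨rearr_inv_mul_le hfi (B.pt_mem n) hQ.le, hle _ ⟨n, rfl⟩⟩
  · rintro ⟨Q, hQ, C, -, hle⟩
    refine RegularOn.of_le_mul (C := C) hfi.aemeasurable
      (B.range_pt_subset.trans Ioc_subset_Ioi_self) hQ.le ?_
    rintro _ ⟨n, rfl⟩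
    have := (hle n).2
    rwa [B.dil_rearr_apply hQ.le] at this

theorem measurable_step (g : ℝ → ℝ) : Measurable (B.step g) :=
  Measurable.tsum fun _ => measurable_const.indicator measurableSet_Ioc

theorem memIdeal_step_of_regularOn (h : RegularOn f (range B.pt)) :
    MemIdeal (B.step (rearrAvg f)) (principal f) := by
  have hfi := L1.integrable_coeFn f
  obtain ⟨C, hC, hle⟩ := h
  have hC0 : 0 < C := zero_lt_one.trans_le hC
  have hdom : ∀ t ∈ Ioc (0 : ℝ) 1, |B.step (rearrAvg f) t| ≤ dominant f C t := by
    intro t ht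
    obtain ⟨n, hn⟩ := B.exists_mem_atom ht
    rw [B.step_apply _ hn, abs_of_nonneg (rearrAvg_nonneg f (B.pt_pos n).le)]
    refine (hle _ ⟨n, rfl⟩).trans (mul_le_mul_of_nonneg_left (add_le_add ?_ le_rfl) hC0.le)
    exact rearr_anti hfi.aemeasurable (mul_pos (inv_pos.2 hC0) ht.1)
      (mul_le_mul_of_nonneg_left hn.2 (inv_pos.2 hC0).le)
  have hint : Integrable (dominant f C) lam := by
    have h1 : IntervalIntegrable (fun t => rearr f (C⁻¹ * t)) volume 0 1 := by
      have := (intervalIntegrable_rearr hfi ⟨le_rfl, zero_le_one⟩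
        ⟨inv_nonneg.2 hC0.le, inv_le_one_of_one_le₀ hC⟩).comp_mul_left (c := C⁻¹)
      rwa [zero_div, div_self (inv_pos.2 hC0).ne'] at this
    have h2 : Integrable (fun t => rearr f (C⁻¹ * t)) lam :=
      (intervalIntegrable_iff_integrableOn_Ioc_of_le zero_le_one).1 h1
    exact (h2.add (integrable_const 1)).const_mul C
  have hi : Integrable (B.step (rearrAvg f)) lam := by
    refine hint.mono' (B.measurable_step _).aestronglyMeasurable ?_
    exact (ae_restrict_iff' measurableSet_Ioc).2 (Eventually.of_forall hdom)
  refine ⟨hi, mem_principal_iff.2 ⟨C, hC, fun t ht => ?_⟩⟩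
  rw [rearr_congr hi.coeFn_toL1]
  refine rearr_le_of_forall_ge (hC0.le.trans (le_dominant hC0.le)) fun x hx htx =>
    (hdom x hx).trans (mul_le_mul_of_nonneg_left (add_le_add ?_ le_rfl) hC0.le)
  exact rearr_anti hfi.aemeasurable (mul_pos (inv_pos.2 hC0) ht.1)
    (mul_le_mul_of_nonneg_left htx (inv_pos.2 hC0).le)

/-- The step function is at least $f^{**}(b_n)$ on all of $(0,b_n]$, so its rearrangement at $b_n/2$
is too. -/
theorem regularOn_of_memIdeal_step (h : MemIdeal (B.step (rearrAvg f)) (principal f)) :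
    RegularOn f (range B.pt) := by
  have hfi := L1.integrable_coeFn f
  obtain ⟨hi, hmem⟩ := h
  obtain ⟨C, hC, hle⟩ := mem_principal_iff.1 hmem
  rw [rearr_congr hi.coeFn_toL1] at hle
  refine ⟨2 * C, by linarith, ?_⟩
  rintro _ ⟨n, rfl⟩
  have hpos := B.pt_pos n
  have hle1 := B.pt_le_one n
  have h1 : rearrAvg f (B.pt n) ≤ rearr (B.step (rearrAvg f)) (B.pt n / 2) := by
    refine le_rearr_of_level hi.aemeasurable (half_pos hpos) fun β hβ hlt => ?_
    have h2 : ENNReal.ofReal (B.pt n / 2) < lam (Ioc 0 (B.pt n)) := by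
      rw [Measure.restrict_apply measurableSet_Ioc, inter_eq_left.2 (Ioc_subset_Ioc_right hle1),
        Real.volume_Ioc, ENNReal.ofReal_lt_ofReal_iff (by linarith)]
      linarith
    refine h2.trans_le (measure_mono fun x hx => ?_)
    obtain ⟨m, hm⟩ := B.exists_mem_atom ⟨hx.1, hx.2.trans hle1⟩
    have hnm : n ≤ m := Nat.lt_succ_iff.1 (B.strictAnti.lt_iff_gt.1 (hm.1.trans_le hx.2))
    rw [mem_ofPred_eq, B.step_apply _ hm]
    exact (hlt.trans_le (rearrAvg_anti hfi (B.pt_pos m) (B.strictAnti.antitone hnm) hle1)).trans_le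
      (le_abs_self _)
  have h3 := hle _ ⟨half_pos hpos, (half_le_self hpos.le).trans hle1⟩
  have h4 : dominant f (2 * C) (B.pt n) = 2 * dominant f C (B.pt n / 2) := by
    rw [dominant, dominant, show (2 * C)⁻¹ * B.pt n = C⁻¹ * (B.pt n / 2) by
      rw [mul_inv]; ring]
    ring
  have h5 : 0 ≤ dominant f C (B.pt n / 2) :=
    (zero_le_one.trans hC).trans (le_dominant (zero_le_one.trans hC))
  linarith

/-- Consecutive points at least halve, so each length is at least the next point, which exceeds the
next length. -/
theorem dyadic_isMonotonic : B.dyadic.IsMonotonic := by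
  have hhalf : ∀ k, 2 * B.dyadic.pt (k + 1) ≤ B.dyadic.pt k := by
    intro k
    have hlt : Nat.nth (· ∈ B.dyadicExp) k + 1 ≤ Nat.nth (· ∈ B.dyadicExp) (k + 1) :=
      Nat.nth_strictMono B.dyadicExp_infinite k.lt_succ_self
    have h1 : (2 : ℝ)⁻¹ ^ Nat.nth (· ∈ B.dyadicExp) (k + 1) ≤
        2⁻¹ ^ (Nat.nth (· ∈ B.dyadicExp) k + 1) :=
      pow_le_pow_of_le_one (by norm_num) (by norm_num) hlt
    rw [pow_succ] at h1
    change 2 * (2 : ℝ)⁻¹ ^ Nat.nth (· ∈ B.dyadicExp) (k + 1) ≤ 2⁻¹ ^ Nat.nth (· ∈ B.dyadicExp) k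
    linarith
  refine antitone_nat_of_succ_le fun k => ?_
  have h1 := hhalf k
  have h2 := B.dyadic.pt_pos (k + 1 + 1)
  rw [len, len]
  linarith

theorem exists_dyadic_pt (n : ℕ) : ∃ k, B.pt n ≤ B.dyadic.pt k ∧ B.dyadic.pt k ≤ 2 * B.pt n := by
  obtain ⟨m, hm, h1, h2⟩ := B.exists_mem_dyadicExp n
  obtain ⟨k, hk⟩ : m ∈ range (Nat.nth (· ∈ B.dyadicExp)) := by
    rw [Nat.range_nth_of_infinite (p := (· ∈ B.dyadicExp)) B.dyadicExp_infinite]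
    exact hm
  have hpt : B.dyadic.pt k = (2 : ℝ)⁻¹ ^ m := by rw [← hk]; rfl
  rw [pow_succ] at h2
  exact ⟨k, by rwa [hpt], by rw [hpt]; linarith⟩

theorem exists_pt_of_dyadic (k : ℕ) : ∃ n, B.pt n ≤ B.dyadic.pt k ∧ B.dyadic.pt k ≤ 2 * B.pt n := by
  obtain ⟨n, hn⟩ : Nat.nth (· ∈ B.dyadicExp) k ∈ B.dyadicExp :=
    Nat.nth_mem_of_infinite B.dyadicExp_infinite k
  have hpt : B.dyadic.pt k = (2 : ℝ) ^ Int.clog 2 (B.pt n) := by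
    rw [hn, zpow_neg, zpow_natCast, ← inv_pow]
    rfl
  refine ⟨n, ?_, ?_⟩
  · rw [hpt]
    simpa using Int.self_le_zpow_clog (b := 2) (by norm_num) (B.pt n)
  · have := Int.zpow_pred_clog_lt_self (b := 2) (by norm_num) (B.pt_pos n)
    rw [Nat.cast_ofNat, zpow_sub_one₀ two_ne_zero] at this
    rw [hpt]
    linarith

theorem regularOn_dyadic_iff : RegularOn f (range B.dyadic.pt) ↔ RegularOn f (range B.pt) := by
  have hfi := L1.integrable_coeFn f
  constructor <;> intro h
  · refine h.of_comparable hfi B.range_pt_subset B.dyadic.range_pt_subset ?_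
    rintro _ ⟨n, rfl⟩
    obtain ⟨k, h1, h2⟩ := B.exists_dyadic_pt n
    exact ⟨_, ⟨k, rfl⟩, h2, by linarith [B.dyadic.pt_pos k]⟩
  · refine h.of_comparable hfi B.dyadic.range_pt_subset B.range_pt_subset ?_
    rintro _ ⟨k, rfl⟩
    obtain ⟨n, h1, h2⟩ := B.exists_pt_of_dyadic k
    exact ⟨_, ⟨n, rfl⟩, by linarith [B.dyadic.pt_pos k], h2⟩

end IntervalPartition

end SymIdeal

end

theorem theorem4p1 (f : SymIdeal.L1I) (B : SymIdeal.IntervalPartition) :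
    (B.Averages (SymIdeal.principal f) →
      ∃ Q : ℝ, 1 < Q ∧ ∀ n : ℕ, 1 ≤ n →
        SymIdeal.rearrAvg f (B.pt n) ≤ Q * SymIdeal.rearr f (Q⁻¹ * B.pt n)) ∧
    (B.IsMonotonic →
      (∃ Q : ℝ, 1 < Q ∧ ∀ n : ℕ, 1 ≤ n →
        SymIdeal.rearrAvg f (B.pt n) ≤ Q * SymIdeal.rearr f (Q⁻¹ * B.pt n)) →
      B.Averages (SymIdeal.principal f)) ∧
    List.TFAE [
      B.Regular f,
      ∃ Q : ℝ, 1 < Q ∧ ∀ n : ℕ, 1 ≤ n →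
        SymIdeal.rearrAvg f (B.star.pt n) ≤ Q * SymIdeal.rearr f (Q⁻¹ * B.star.pt n),
      ∃ Q : ℝ, 1 < Q ∧
        SymIdeal.FunEquiv (B.star.step (SymIdeal.rearrAvg f))
          (B.star.step (SymIdeal.dil Q⁻¹ (SymIdeal.rearr f))),
      SymIdeal.MemIdeal (B.star.step (SymIdeal.rearrAvg f)) (SymIdeal.principal f),
      B.star.dyadic.Regular f] := by
  refine ⟨fun h => B.regularOn_range_iff.1 (B.regularOn_of_averages h),
    fun hB h => B.averages_of_regularOn hB (B.regularOn_range_iff.2 h), ?_⟩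
  rw [← B.star.regularOn_range_iff, ← B.star.regularOn_iff_funEquiv]
  tfae_have 1 ↔ 2 := B.star.averages_iff B.star_isMonotonic
  -- The rewriting above has turned both items into `RegularOn` for the points of $\mathcal B^*$.
  tfae_have 2 ↔ 3 := Iff.rfl
  tfae_have 2 → 4 := B.star.memIdeal_step_of_regularOn
  tfae_have 4 → 2 := B.star.regularOn_of_memIdeal_step
  tfae_have 5 ↔ 2 := by
    -- Regularity is defined through `star`, which leaves the points of the monotonic diadic
    -- projection unchanged.
    rw [← B.star.regularOn_dyadic_iff, ← B.star.dyadic.star_pt_eq B.star.dyadic_isMonotonic]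
    exact B.star.dyadic.star.averages_iff B.star.dyadic.star_isMonotonic
  tfae_finish
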